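/- Let $\{U_n\}_{n\in\mathbb Z}$ be a real stationary Gaussian process and let $\{N_n\}_{n\in\mathbb Z}$ be white Gaussian noise (i.i.d. $\mathcal N(0,\theta)$ variables with $\theta>0$) independent of the process $\{U_n\}$. Consider the prediction loop with input $\{U_n\}$ and output $\{V_n\}$ given, for all $n\in\mathbb Z$, by $$\hat U_n=g_n(V_n^-),\qquad Z_n=U_n-\hat U_n,\qquad Zq_n=Z_n+N_n,\qquad V_n=\hat U_n+Zq_n,$$ where $V_n^-=(V_{n-1},V_{n-2},\ldots)$, and suppose that $\hat U_n$ is the optimum infinite-order predictor of $U_n$ from $V_n^-$, i.e. $g_n$ is measurable and $E(U_n-\hat U_n)^2\le E(U_n-h(V_n^-))^2$ for every measurable function $h$. Then, for every $n$, the mutual-information rate $$\overline I(\{U_n\};\{V_n\})=\lim_{m\to\infty}\frac1m\, I(U_1,\ldots,U_m;V_1,\ldots,V_m)$$ exists and equals the scalar mutual information $I(Z_n;Z_n+N_n)$. Moreover the variance of $Z_n$ is $\sigma_\infty^2=\lim_{L\to\infty}\sigma_L^2$, where $\sigma_L^2=\inf_{a_1,\ldots,a_L}E\bigl(U_n-\sum_{i=1}^L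 a_iV_{n-i}\bigr)^2$ is the error of optimum $L$-th order linear prediction. -/

import Mathlib

open MeasureTheory ProbabilityTheory Filter Topology
open scoped ENNReal NNReal

/-- Mutual information `I(X; Y)` (in nats) of two random elements: the Kullback-Leibler divergence
of the joint law from the product of the marginal laws. -/
noncomputable def mutualInfo {Ω α β : Type*} [MeasurableSpace Ω] [MeasurableSpace α]
    [MeasurableSpace β] (P : Measure Ω) (X : Ω → α) (Y : Ω → β) : ℝ≥0∞ :=
  InformationTheory.klDiv (P.map (fun ω => (X ω, Y ω))) ((P.map X).prod (P.map Y))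

/-- The mutual information rate of `X` and `Y` exists and equals `r`:
`(1/n) I(X₁, …, Xₙ; Y₁, …, Yₙ) → r` as `n → ∞`. -/
def HasMutualInfoRate {Ω : Type*} [MeasurableSpace Ω] (P : Measure Ω) (X Y : ℤ → Ω → ℝ)
    (r : ℝ≥0∞) : Prop :=
  Tendsto (fun n : ℕ =>
      mutualInfo P (fun ω (i : Fin n) => X ((i : ℤ) + 1) ω)
        (fun ω (i : Fin n) => Y ((i : ℤ) + 1) ω) / (n : ℝ≥0∞))
    atTop (𝓝 r)

/-- A two-sided real process is (strictly) stationary: its law is invariant under time shifts. -/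
def IsStationaryProcess {Ω : Type*} [MeasurableSpace Ω] (P : Measure Ω) (X : ℤ → Ω → ℝ) : Prop :=
  ∀ k : ℤ, IdentDistrib (fun ω (n : ℤ) => X (n + k) ω) (fun ω (n : ℤ) => X n ω) P P

/-- White Gaussian noise of variance `θ`: independent `N(0, θ)` variables. -/
structure IsWhiteGaussianNoise {Ω : Type*} [MeasurableSpace Ω] (P : Measure Ω) (N : ℤ → Ω → ℝ)
    (θ : ℝ≥0) : Prop where
  hasLaw : ∀ n, HasLaw (N n) (gaussianReal 0 θ) P
  iIndepFun : iIndepFun N P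

/-- The infinite past `(V (n-1), V (n-2), …)` of `V` before time `n`. -/
def infinitePast {Ω : Type*} (V : ℤ → Ω → ℝ) (n : ℤ) (ω : Ω) : ℕ → ℝ :=
  fun i => V (n - ((i : ℤ) + 1)) ω

/-- The mean-squared error `E (X - Y)²`. -/
noncomputable def meanSqError {Ω : Type*} [MeasurableSpace Ω] (P : Measure Ω) (X Y : Ω → ℝ) :
    ℝ≥0∞ :=
  ∫⁻ ω, ENNReal.ofReal ((X ω - Y ω) ^ 2) ∂P

/-- The recursion of the prediction loop with input `U`, additive noise `N` and output `V`. The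
predictor output `Uhat n` is the function `g n` of the infinite past of `V`, `Z` is the prediction
error and `Zq` its noisy version. -/
structure IsPredictionLoop {Ω : Type*} (g : ℤ → (ℕ → ℝ) → ℝ) (U N Uhat Z Zq V : ℤ → Ω → ℝ) :
    Prop where
  predictor : ∀ n ω, Uhat n ω = g n (infinitePast V n ω)
  error : ∀ n ω, Z n ω = U n ω - Uhat n ω
  channel : ∀ n ω, Zq n ω = Z n ω + N n ω
  output : ∀ n ω, V n ω = Uhat n ω + Zq n ω

/-- `g` is an optimum infinite-order predictor of `U n` from the past of `V` before time `n`: among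
all measurable functions of that past it has the least mean-squared error. -/
structure IsOptimalPredictor {Ω : Type*} [MeasurableSpace Ω] (P : Measure Ω) (U V : ℤ → Ω → ℝ)
    (n : ℤ) (g : (ℕ → ℝ) → ℝ) : Prop where
  measurable : Measurable g
  le : ∀ h : (ℕ → ℝ) → ℝ, Measurable h →
    meanSqError P (U n) (fun ω => g (infinitePast V n ω)) ≤
      meanSqError P (U n) (fun ω => h (infinitePast V n ω))

/-- The mean-squared error `σ_L²` of optimum linear prediction of `U n` from
`V (n-1), …, V (n-L)`. -/
noncomputable def linearPredictionError {Ω : Type*} [MeasurableSpace Ω] (P : Measure Ω)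
    (U V : ℤ → Ω → ℝ) (n : ℤ) (L : ℕ) : ℝ≥0∞ :=
  ⨅ a : Fin L → ℝ, meanSqError P (U n) (fun ω => ∑ i, a i * V (n - ((i : ℤ) + 1)) ω)

/-! The prediction is subtracted before the noise and added back after it, so V = U + N. The loop is
thus a white Gaussian noise channel, (U, V) is jointly Gaussian and stationary, and the predictor
matters only through Z.

Fix n and let R_L be the error of the best affine prediction of U_n from L past outputs. It is
uncorrelated with these outputs, hence independent of them, so the prediction is a conditional
expectation (`condExp_input_ae_eq`). In L², R_L tends to some r. By Lévy's upward theorem U_n - r is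
the conditional expectation given the infinite past, so Z_n = r almost surely (`error_ae_eq`). Hence
Z_n is centred Gaussian with variance lim Var R_L. It is independent of N_n, so I(Z_n; Z_n + N_n) =
½ log((Var Z_n + θ)/θ).

For a block, a unit triangular affine map takes V_1, …, V_m to the innovations R_k + N_{k+1}, k < m,
where R_k now predicts U_{k+1}. These are independent, the output density factors, and the block
information is the sum of ½ log((Var R_k + θ)/θ) over k < m (`mutualInfo_block`). The terms
converge, so their Cesàro means have the same limit.

The errors σ_L² allow no constant term, while U may have a nonzero mean. In the limit stationarity
makes the constant superfluous: the least-norm point M of the closed affine span of the past outputs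
has inner product ‖M‖² with every one of them and with V_n (`exists_mean_of_stationary`), so it can
stand in for the constant. The infinite-order linear error is therefore already centred, and equals
r. -/

open scoped RealInnerProductSpace

/-! ### Building Gaussian processes. -/

/-- Linear combinations of a Gaussian process form a Gaussian process. -/
lemma isGaussianProcess_of_mem_span {Ω T S : Type*} [MeasurableSpace Ω] {P : Measure Ω}
    {X : T → Ω → ℝ} {Y : S → Ω → ℝ} (hX : IsGaussianProcess X P)
    (h : ∀ s, Y s ∈ Submodule.span ℝ (Set.range X)) : IsGaussianProcess Y P := by
  refine hX.of_isGaussianProcess fun s => ?_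
  obtain ⟨c, hc⟩ := Finsupp.mem_span_range_iff_exists_finsupp.1 (h s)
  refine ⟨c.support, ∑ i : c.support, c i • ContinuousLinearMap.proj i, fun ω => ?_⟩
  rw [← hc, Finsupp.sum, Finset.sum_apply]
  simp only [Pi.smul_apply, smul_eq_mul, sum_apply,
    smul_apply, ContinuousLinearMap.proj_apply, Finset.restrict]
  exact (Finset.sum_coe_sort c.support (fun i => c i * X i ω)).symm

/-- Independent Gaussian variables form a Gaussian process. -/
lemma isGaussianProcess_of_iIndepFun {Ω T : Type*} [MeasurableSpace Ω] {P : Measure Ω}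
    {X : T → Ω → ℝ} (hX : ∀ t, HasGaussianLaw (X t) P) (h : iIndepFun X P) :
    IsGaussianProcess X P where
  hasGaussianLaw I :=
    iIndepFun.hasGaussianLaw (fun i : I => hX i) (h.precomp Subtype.val_injective)

/-- Two independent Gaussian processes are jointly Gaussian. -/
lemma isGaussianProcess_sumElim {Ω S T : Type*} [MeasurableSpace Ω] {P : Measure Ω}
    {X : S → Ω → ℝ} {Y : T → Ω → ℝ} (hX : IsGaussianProcess X P) (hY : IsGaussianProcess Y P)
    (h : IndepFun (fun ω s => X s ω) (fun ω t => Y t ω) P) :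
    IsGaussianProcess (Sum.elim X Y) P where
  hasGaussianLaw I := by
    classical
    let I₁ : Finset S := I.toLeft
    let I₂ : Finset T := I.toRight
    have hind : IndepFun (fun ω => I₁.restrict (X · ω)) (fun ω => I₂.restrict (Y · ω)) P :=
      h.comp (φ := fun x => I₁.restrict x) (ψ := fun y => I₂.restrict y)
        (Finset.measurable_restrict I₁) (Finset.measurable_restrict I₂)
    have hg := hind.hasGaussianLaw (hX.hasGaussianLaw I₁) (hY.hasGaussianLaw I₂)
    let f : (i : I) → ((I₁ → ℝ) × (I₂ → ℝ)) →L[ℝ] ℝ := fun i => match i with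
      | ⟨.inl s, hs⟩ => (ContinuousLinearMap.proj ⟨s, Finset.mem_toLeft.2 hs⟩).comp
          (ContinuousLinearMap.fst ℝ _ _)
      | ⟨.inr t, ht⟩ => (ContinuousLinearMap.proj ⟨t, Finset.mem_toRight.2 ht⟩).comp
          (ContinuousLinearMap.snd ℝ _ _)
    have := hg.map (ContinuousLinearMap.pi f)
    convert! this using 1
    ext ω i
    obtain ⟨i | i, hi⟩ := i <;> rfl

/-! ### Densities and the information across a Gaussian channel. -/

/-- The Kullback-Leibler divergence of two measures with positive densities. -/
lemma klDiv_eq_integral_log_sub_log {α : Type*} [MeasurableSpace α] {τ μ ν : Measure α}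
    [IsProbabilityMeasure μ] [IsProbabilityMeasure ν] {p q : α → ℝ}
    (hp : Measurable p) (hq : Measurable q) (hp0 : ∀ x, 0 < p x) (hq0 : ∀ x, 0 < q x)
    (hμ : μ = τ.withDensity fun x => ENNReal.ofReal (p x))
    (hν : ν = τ.withDensity fun x => ENNReal.ofReal (q x))
    (hint : Integrable (fun x => Real.log (p x) - Real.log (q x)) μ) :
    InformationTheory.klDiv μ ν =
      ENNReal.ofReal (∫ x, (Real.log (p x) - Real.log (q x)) ∂μ) := by
  have hμν : μ = ν.withDensity (fun x => ENNReal.ofReal (p x / q x)) := by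
    rw [hμ, hν, ← withDensity_mul _ hq.ennreal_ofReal
      (g := fun x => ENNReal.ofReal (p x / q x)) (hp.div hq).ennreal_ofReal]
    congr 1
    ext x
    rw [Pi.mul_apply, ← ENNReal.ofReal_mul (hq0 x).le, mul_div_cancel₀ _ (hq0 x).ne']
  have hac : μ ≪ ν := by
    rw [hμν]
    exact withDensity_absolutelyContinuous _ _
  have hllr : llr μ ν =ᵐ[μ] fun x => Real.log (p x) - Real.log (q x) := by
    have h : μ.rnDeriv ν =ᵐ[ν] fun x => ENNReal.ofReal (p x / q x) := by
      conv_lhs => rw [hμν]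
      exact Measure.rnDeriv_withDensity ν (hp.div hq).ennreal_ofReal
    filter_upwards [hac.ae_le h] with x hx
    rw [llr, hx, ENNReal.toReal_ofReal (div_pos (hp0 x) (hq0 x)).le,
      Real.log_div (hp0 x).ne' (hq0 x).ne']
  rw [InformationTheory.klDiv_of_ac_of_integrable hac (hint.congr hllr.symm),
    integral_congr_ae hllr]
  -- The total-mass correction in `klDiv` vanishes for probability measures.
  simp

/-- The density of a product of nondegenerate real Gaussian measures. -/
lemma pi_gaussianReal_eq_withDensity {ι : Type*} [Fintype ι] {v : ι → ℝ≥0} (hv : ∀ i, v i ≠ 0) :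
    Measure.pi (fun i => gaussianReal 0 (v i)) =
      volume.withDensity fun x : ι → ℝ => ENNReal.ofReal (∏ i, gaussianPDFReal 0 (v i) (x i)) := by
  refine Measure.pi_eq fun s hs => ?_
  have hnn : ∀ x : ι → ℝ, 0 ≤ ∏ i, gaussianPDFReal 0 (v i) (x i) := fun x =>
    Finset.prod_nonneg fun i _ => gaussianPDFReal_nonneg _ _ _
  have hint : Integrable (fun x : ι → ℝ => ∏ i, gaussianPDFReal 0 (v i) (x i)) :=
    Integrable.fintype_prod fun i => integrable_gaussianPDFReal 0 (v i)
  rw [withDensity_apply _ (MeasurableSet.univ_pi hs),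
    ← ofReal_integral_eq_lintegral_ofReal hint.integrableOn (Eventually.of_forall hnn),
    volume_pi, Measure.restrict_pi_pi,
    integral_fintype_prod_eq_prod (f := fun i x => gaussianPDFReal 0 (v i) x),
    ENNReal.ofReal_prod_of_nonneg]
  · exact Finset.prod_congr rfl fun i _ => (gaussianReal_apply_eq_integral 0 (hv i) (s i)).symm
  · exact fun i _ => integral_nonneg fun x => gaussianPDFReal_nonneg _ _ _

lemma log_gaussianPDFReal {v : ℝ≥0} (hv : v ≠ 0) (x : ℝ) :
    Real.log (gaussianPDFReal 0 v x) = -(Real.log (2 * Real.pi * v) / 2) - x ^ 2 / (2 * v) := by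
  have hv' : (0 : ℝ) < v := by positivity
  rw [gaussianPDFReal, Real.log_mul (by positivity) (by positivity), Real.log_inv,
    Real.log_sqrt (by positivity), Real.log_exp]
  ring

/-- The expected log-density of a Gaussian variable is minus its differential entropy. -/
lemma integral_log_gaussianPDFReal {Ω : Type*} [MeasurableSpace Ω] {P : Measure Ω} {v : ℝ≥0}
    (hv : v ≠ 0) {X : Ω → ℝ} (hX : HasLaw X (gaussianReal 0 v) P) :
    Integrable (fun ω => Real.log (gaussianPDFReal 0 v (X ω))) P ∧
      ∫ ω, Real.log (gaussianPDFReal 0 v (X ω)) ∂P =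
        -(Real.log (2 * Real.pi * v) / 2) - 1 / 2 := by
  have hv' : (0 : ℝ) < v := by positivity
  have hG : HasGaussianLaw X P := hX.hasGaussianLaw
  have := hG.isProbabilityMeasure
  have h2 : Integrable (fun ω => X ω ^ 2) P := hG.memLp_two.integrable_sq
  have hmean : P[X] = 0 := by rw [hX.integral_eq, integral_id_gaussianReal]
  have hvar : ∫ ω, X ω ^ 2 ∂P = v := by
    rw [← variance_of_integral_eq_zero hX.aemeasurable hmean, hX.variance_eq,
      variance_id_gaussianReal]
  simp only [log_gaussianPDFReal hv]
  refine ⟨(integrable_const _).sub (h2.div_const _), ?_⟩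
  rw [integral_sub (integrable_const _) (h2.div_const _), integral_div, hvar]
  simp only [integral_const, probReal_univ, one_smul]
  field_simp

/-- A unimodular affine map of a random vector into independent nondegenerate Gaussian variables
determines its density. -/
lemma map_eq_withDensity_of_innovations {Ω ι : Type*} [MeasurableSpace Ω] [Fintype ι]
    [DecidableEq ι] {P : Measure Ω} [IsProbabilityMeasure P] {Y : Ω → ι → ℝ} (hY : Measurable Y)
    {A : Matrix ι ι ℝ} (hA : A.det = 1) (b : ι → ℝ) {s : ι → ℝ≥0} (hs : ∀ i, s i ≠ 0)
    (hE : ∀ i, HasLaw (fun ω => (A.mulVec (Y ω) - b) i) (gaussianReal 0 (s i)) P)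
    (hind : iIndepFun (fun i ω => (A.mulVec (Y ω) - b) i) P) :
    P.map Y = volume.withDensity fun y =>
      ENNReal.ofReal (∏ i, gaussianPDFReal 0 (s i) ((A.mulVec y - b) i)) := by
  have hm : Measurable fun y : ι → ℝ => A.mulVec y - b :=
    ((Matrix.toLin' A).continuous_of_finiteDimensional.measurable).sub_const b
  have hvol : MeasurePreserving (fun y : ι → ℝ => A.mulVec y - b) := by
    refine ⟨hm, ?_⟩
    have h1 : MeasurePreserving (Matrix.toLin' A) (volume : Measure (ι → ℝ)) volume :=
      ⟨(Matrix.toLin' A).continuous_of_finiteDimensional.measurable, by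
        rw [Real.map_matrix_volume_pi_eq_smul_volume_pi (by rw [hA]; exact one_ne_zero), hA]
        simp⟩
    exact ((measurePreserving_sub_right volume b).comp h1).map_eq
  have hinj : Function.Injective fun y : ι → ℝ => A.mulVec y - b := fun x y hxy =>
    Matrix.mulVec_injective_of_isUnit
      ((Matrix.isUnit_iff_isUnit_det A).2 (by rw [hA]; exact isUnit_one)) (sub_left_injective hxy)
  have hemb : MeasurableEmbedding fun y : ι → ℝ => A.mulVec y - b :=
    (hm).measurableEmbedding hinj
  have hprod : Measurable fun x : ι → ℝ =>
      ENNReal.ofReal (∏ i, gaussianPDFReal 0 (s i) (x i)) := by fun_prop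
  have hmap : (P.map Y).map (fun y => A.mulVec y - b) =
      (volume.withDensity fun y : ι → ℝ =>
        ENNReal.ofReal (∏ i, gaussianPDFReal 0 (s i) ((A.mulVec y - b) i))).map
          (fun y => A.mulVec y - b) := by
    have h1 : (P.map Y).map (fun y => A.mulVec y - b) =
        Measure.pi (fun i => gaussianReal 0 (s i)) := by
      rw [Measure.map_map hm hY]
      have := (iIndepFun_iff_map_fun_eq_pi_map fun i => (hE i).aemeasurable).1 hind
      simp only [fun i => (hE i).map_eq] at this
      exact this
    rw [h1, pi_gaussianReal_eq_withDensity hs]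
    ext t ht
    rw [Measure.map_apply hm ht, withDensity_apply _ ht, withDensity_apply _ (hm ht),
      ← hvol.setLIntegral_comp_preimage ht hprod]
  -- Both measures have the same image under the affine map; since that map is a measurable
  -- embedding, the image determines the measure.
  ext t ht
  have := congrArg (fun μ => μ ((fun y => A.mulVec y - b) '' t)) hmap
  simpa only [hemb.map_apply, Set.preimage_image_eq _ hinj] using this

/-- Mutual information across an additive white Gaussian noise channel, in terms of the variances of
the innovations of the output. -/
lemma mutualInfo_add_gaussian {Ω ι : Type*} [MeasurableSpace Ω] [Fintype ι] [DecidableEq ι]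
    {P : Measure Ω} [IsProbabilityMeasure P] {X N : Ω → ι → ℝ} (hX : Measurable X)
    (hN : Measurable N) (hXN : IndepFun X N P) {θ : ℝ≥0} (hθ : θ ≠ 0)
    (hNlaw : ∀ i, HasLaw (fun ω => N ω i) (gaussianReal 0 θ) P)
    (hNind : iIndepFun (fun i ω => N ω i) P)
    {A : Matrix ι ι ℝ} (hA : A.det = 1) (b : ι → ℝ) {s : ι → ℝ≥0} (hs : ∀ i, s i ≠ 0)
    (hE : ∀ i, HasLaw (fun ω => (A.mulVec (X ω + N ω) - b) i) (gaussianReal 0 (s i)) P)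
    (hind : iIndepFun (fun i ω => (A.mulVec (X ω + N ω) - b) i) P) :
    mutualInfo P X (fun ω => X ω + N ω) =
      ENNReal.ofReal (∑ i, Real.log (s i / θ) / 2) := by
  have hY : Measurable fun ω => X ω + N ω := hX.add hN
  have := Measure.isProbabilityMeasure_map (μ := P) hX.aemeasurable
  have := Measure.isProbabilityMeasure_map (μ := P) hY.aemeasurable
  have := Measure.isProbabilityMeasure_map (μ := P) (hX.prodMk hY).aemeasurable
  have hm : Measurable fun y : ι → ℝ => A.mulVec y - b :=
    ((Matrix.toLin' A).continuous_of_finiteDimensional.measurable).sub_const b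
  let p : (ι → ℝ) × (ι → ℝ) → ℝ := fun z => ∏ i, gaussianPDFReal 0 θ (z.2 i - z.1 i)
  let q : (ι → ℝ) × (ι → ℝ) → ℝ := fun z => ∏ i, gaussianPDFReal 0 (s i) ((A.mulVec z.2 - b) i)
  have hp : Measurable p := by fun_prop
  have hq' : Measurable fun y : ι → ℝ => ∏ i, gaussianPDFReal 0 (s i) ((A.mulVec y - b) i) :=
    Finset.measurable_prod _ fun i _ =>
      (measurable_gaussianPDFReal 0 (s i)).comp ((measurable_pi_apply i).comp hm)
  have hq : Measurable q := hq'.comp measurable_snd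
  have hlogp : ∀ z, Real.log (p z) = ∑ i, Real.log (gaussianPDFReal 0 θ (z.2 i - z.1 i)) :=
    fun z => Real.log_prod fun i _ => (gaussianPDFReal_pos _ _ _ hθ).ne'
  have hlogq : ∀ z, Real.log (q z) =
      ∑ i, Real.log (gaussianPDFReal 0 (s i) ((A.mulVec z.2 - b) i)) :=
    fun z => Real.log_prod fun i _ => (gaussianPDFReal_pos _ _ _ (hs i)).ne'
  -- The reference measure is `(P.map X).prod volume`, so that the input needs no density and may be
  -- degenerate. The shear (x, y) ↦ (x, x + y) preserves it and carries the noise density to `p`.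
  have hμ : P.map (fun ω => (X ω, X ω + N ω)) =
      ((P.map X).prod volume).withDensity fun z => ENNReal.ofReal (p z) := by
    have hNmap : P.map N = volume.withDensity fun x : ι → ℝ =>
        ENNReal.ofReal (∏ i, gaussianPDFReal 0 θ (x i)) := by
      rw [← pi_gaussianReal_eq_withDensity fun _ => hθ]
      have := (iIndepFun_iff_map_fun_eq_pi_map fun i => (hNlaw i).aemeasurable).1 hNind
      simpa only [fun i => (hNlaw i).map_eq] using this
    have hφ : MeasurePreserving (fun z : (ι → ℝ) × (ι → ℝ) => (z.1, z.1 + z.2))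
        ((P.map X).prod volume) ((P.map X).prod volume) :=
      (MeasurePreserving.id _).skew_product (by fun_prop)
        (Eventually.of_forall fun x => (measurePreserving_add_left volume x).map_eq)
    have hjoint := (indepFun_iff_map_prod_eq_prod_map_map hX.aemeasurable hN.aemeasurable).1 hXN
    have hcomp : (fun ω => (X ω, X ω + N ω)) =
        (fun z : (ι → ℝ) × (ι → ℝ) => (z.1, z.1 + z.2)) ∘ fun ω => (X ω, N ω) := rfl
    rw [hcomp, ← Measure.map_map hφ.measurable (hX.prodMk hN), hjoint, hNmap,
      prod_withDensity_right (by fun_prop)]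
    ext t ht
    rw [Measure.map_apply hφ.measurable ht, withDensity_apply _ ht,
      withDensity_apply _ (hφ.measurable ht),
      ← hφ.setLIntegral_comp_preimage ht hp.ennreal_ofReal]
    simp [p]
  have hν : (P.map X).prod (P.map fun ω => X ω + N ω) =
      ((P.map X).prod volume).withDensity fun z => ENNReal.ofReal (q z) := by
    rw [map_eq_withDensity_of_innovations hY hA b hs hE hind,
      prod_withDensity_right hq'.ennreal_ofReal]
  have hN1 := fun i => integral_log_gaussianPDFReal hθ (hNlaw i)
  have hE1 := fun i => integral_log_gaussianPDFReal (hs i) (hE i)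
  have hmeas : Measurable fun z => Real.log (p z) - Real.log (q z) := hp.log.sub hq.log
  have hpq : (fun z => Real.log (p z) - Real.log (q z)) ∘ (fun ω => (X ω, X ω + N ω)) =
      fun ω => ∑ i, Real.log (gaussianPDFReal 0 θ (N ω i)) -
        ∑ i, Real.log (gaussianPDFReal 0 (s i) ((A.mulVec (X ω + N ω) - b) i)) := by
    ext ω
    simp [hlogp, hlogq]
  have hi1 := integrable_finsetSum Finset.univ fun i _ => (hN1 i).1
  have hi2 := integrable_finsetSum Finset.univ fun i _ => (hE1 i).1
  rw [mutualInfo, klDiv_eq_integral_log_sub_log hp hq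
    (fun z => Finset.prod_pos fun i _ => gaussianPDFReal_pos _ _ _ hθ)
    (fun z => Finset.prod_pos fun i _ => gaussianPDFReal_pos _ _ _ (hs i)) hμ hν]
  · congr 1
    rw [integral_map (hX.prodMk hY).aemeasurable hmeas.aestronglyMeasurable]
    refine (integral_congr_ae (Eventually.of_forall (congrFun hpq))).trans ?_
    rw [integral_sub hi1 hi2, integral_finsetSum _ fun i _ => (hN1 i).1,
      integral_finsetSum _ fun i _ => (hE1 i).1, ← Finset.sum_sub_distrib]
    refine Finset.sum_congr rfl fun i _ => ?_
    have h1 : (0 : ℝ) < θ := by positivity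
    have h2 : (0 : ℝ) < s i := NNReal.coe_pos.2 (pos_iff_ne_zero.2 (hs i))
    -- The terms -½ and ½ log 2π cancel between the two entropies.
    rw [(hN1 i).2, (hE1 i).2, Real.log_div h2.ne' h1.ne', Real.log_mul (by positivity) h1.ne',
      Real.log_mul (by positivity) h2.ne']
    ring
  · rw [integrable_map_measure hmeas.aestronglyMeasurable (hX.prodMk hY).aemeasurable, hpq]
    exact hi1.sub hi2

/-- Data processing: mutual information does not increase under measurable maps. -/
lemma mutualInfo_comp_le {Ω α β γ δ : Type*} [MeasurableSpace Ω] [MeasurableSpace α]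
    [MeasurableSpace β] [MeasurableSpace γ] [MeasurableSpace δ] {P : Measure Ω}
    [IsProbabilityMeasure P] {X : Ω → α} {Y : Ω → β} (hX : Measurable X) (hY : Measurable Y)
    {f : α → γ} {g : β → δ} (hf : Measurable f) (hg : Measurable g) :
    mutualInfo P (fun ω => f (X ω)) (fun ω => g (Y ω)) ≤ mutualInfo P X Y := by
  have := Measure.isProbabilityMeasure_map (μ := P) hX.aemeasurable
  have := Measure.isProbabilityMeasure_map (μ := P) hY.aemeasurable
  have := Measure.isProbabilityMeasure_map (μ := P) (hX.prodMk hY).aemeasurable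
  have h := InformationTheory.klDiv_map_le (P.map fun ω => (X ω, Y ω))
    ((P.map X).prod (P.map Y)) (hf.prodMap hg)
  rw [Measure.map_map (hf.prodMap hg) (hX.prodMk hY), ← Measure.map_prod_map _ _ hf hg,
    Measure.map_map hf hX, Measure.map_map hg hY] at h
  exact h

/-- The mutual information across a scalar additive Gaussian noise channel with Gaussian input. -/
lemma mutualInfo_add_gaussian_real {Ω : Type*} [MeasurableSpace Ω] {P : Measure Ω}
    [IsProbabilityMeasure P] {X N : Ω → ℝ} (hX : Measurable X) (hN : Measurable N)
    (hXN : IndepFun X N P) {v θ : ℝ≥0} (hθ : θ ≠ 0) (hXlaw : HasLaw X (gaussianReal 0 v) P)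
    (hNlaw : HasLaw N (gaussianReal 0 θ) P) :
    mutualInfo P X (fun ω => X ω + N ω) =
      ENNReal.ofReal (Real.log (((v + θ : ℝ≥0) : ℝ) / θ) / 2) := by
  have hX' : Measurable fun ω (_ : Unit) => X ω := measurable_pi_iff.2 fun _ => hX
  have hN' : Measurable fun ω (_ : Unit) => N ω := measurable_pi_iff.2 fun _ => hN
  have hsum : HasLaw (X + N) (gaussianReal 0 (v + θ)) P := by
    refine ⟨(hX.add hN).aemeasurable, ?_⟩
    rw [hXN.map_add_eq_map_conv_map hX hN, hXlaw.map_eq, hNlaw.map_eq, gaussianReal_conv_gaussianReal,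
      add_zero]
  have key := mutualInfo_add_gaussian (P := P) hX' hN'
    (hXN.comp (φ := fun x (_ : Unit) => x) (ψ := fun x (_ : Unit) => x) (by fun_prop) (by fun_prop))
    hθ (fun _ => hNlaw) iIndepFun.of_subsingleton (A := 1) Matrix.det_one 0
    (s := fun _ => v + θ) (fun _ => (lt_of_lt_of_le (pos_iff_ne_zero.2 hθ) le_add_self).ne')
    (fun _ => by simpa using! hsum) iIndepFun.of_subsingleton
  simp only [Finset.univ_unique, Finset.sum_singleton] at key
  rw [← key]
  -- Scalars and `Unit`-indexed vectors are functions of each other, so data processing applies both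
  -- ways.
  refine le_antisymm ?_ ?_
  · exact mutualInfo_comp_le hX' (hX'.add hN') (measurable_pi_apply ()) (measurable_pi_apply ())
  · exact mutualInfo_comp_le (f := fun x (_ : Unit) => x) (g := fun x (_ : Unit) => x) hX
      (hX.add hN) (by fun_prop) (by fun_prop)

/-! ### Hilbert space geometry of stationary sequences. -/

section Hilbert

variable {H : Type*} [NormedAddCommGroup H] [InnerProductSpace ℝ H]

/-- A vector is orthogonal to the closure of a span as soon as it is orthogonal to generators. -/
lemma inner_eq_zero_of_mem_closure_span {s : Set H} {x : H} (h : ∀ y ∈ s, ⟪x, y⟫ = 0) {z : H}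
    (hz : z ∈ (Submodule.span ℝ s).topologicalClosure) : ⟪x, z⟫ = 0 := by
  have : (Submodule.span ℝ s).topologicalClosure ≤ (ℝ ∙ x)ᗮ := by
    refine Submodule.topologicalClosure_minimal _ (Submodule.span_le.2 fun y hy => ?_)
      (Submodule.isClosed_orthogonal _)
    exact Submodule.mem_orthogonal_singleton_iff_inner_right.2 (h y hy)
  exact Submodule.mem_orthogonal_singleton_iff_inner_right.1 (this hz)

/-- The mean of a stationary sequence `w` (the point of least norm of the closed affine span of
`w 1, w 2, …`) has the same inner product with all the terms, `w 0` included. -/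
lemma exists_mean_of_stationary [CompleteSpace H] {w : ℕ → H}
    (hw : ∀ i j, ⟪w (i + 1), w (j + 1)⟫ = ⟪w i, w j⟫) :
    ∃ M ∈ (Submodule.span ℝ (Set.range fun i => w (i + 1))).topologicalClosure,
      (∀ i, ⟪M, w i⟫ = ‖M‖ ^ 2) ∧
      ∀ (e : H) (c : ℝ), (∀ i, ⟪e, w (i + 1)⟫ = c) → ⟪e, M⟫ = c := by
  -- Directions of the affine span; its least-norm point is `w 1` minus its projection onto their
  -- closed span `D`.
  let f : ℕ → H := fun i => w (i + 1) - w 1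
  let D := (Submodule.span ℝ (Set.range f)).topologicalClosure
  have hDc : IsClosed (D : Set H) := Submodule.isClosed_topologicalClosure _
  have : CompleteSpace D := hDc.completeSpace_coe
  let d : H := D.starProjection (w 1)
  have hd : d ∈ D := Submodule.starProjection_apply_mem _ _
  let M : H := w 1 - d
  have hMD : ∀ x ∈ D, ⟪M, x⟫ = 0 := fun x hx =>
    Submodule.inner_left_of_mem_orthogonal hx (Submodule.sub_starProjection_mem_orthogonal (w 1))
  have hMi : ∀ i, ⟪M, w (i + 1)⟫ = ⟪M, w 1⟫ := by
    intro i
    have := hMD (f i) (Submodule.le_topologicalClosure _ (Submodule.subset_span ⟨i, rfl⟩))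
    rw [inner_sub_right] at this
    linarith
  have hM1 : ⟪M, w 1⟫ = ‖M‖ ^ 2 := by
    have h1 : w 1 = M + d := by simp [M]
    conv_lhs => rw [h1, inner_add_right, hMD d hd, add_zero]
    exact real_inner_self_eq_norm_sq M
  have hfC : D ≤ (Submodule.span ℝ (Set.range fun i => w (i + 1))).topologicalClosure := by
    refine Submodule.topologicalClosure_mono (Submodule.span_le.2 ?_)
    rintro _ ⟨i, rfl⟩
    exact sub_mem (Submodule.subset_span ⟨i, rfl⟩) (Submodule.subset_span ⟨0, rfl⟩)
  refine ⟨M, sub_mem (Submodule.le_topologicalClosure _ (Submodule.subset_span ⟨0, rfl⟩)) (hfC hd),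
    ?_, ?_⟩
  · suffices h0 : ⟪M, w 0⟫ = ‖M‖ ^ 2 by
      intro i
      cases i with
      | zero => exact h0
      | succ i => rw [hMi, hM1]
    -- approximate `d` by finite combinations and shift these
    obtain ⟨x, hx, hxd⟩ := mem_closure_iff_seq_limit.1
      (show d ∈ closure ((Submodule.span ℝ (Set.range f) : Submodule ℝ H) : Set H) from hd)
    have hc : ∀ n, ∃ c : ℕ →₀ ℝ, (c.sum fun i a => a • f i) = x n := fun n =>
      Finsupp.mem_span_range_iff_exists_finsupp.1 (hx n)
    choose c hc using hc
    let x' : ℕ → H := fun n => (c n).sum fun i a => a • (w (i + 2) - w 2)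
    -- The correction `w 1 - w 2` moves the base point, so that `w 2 - x' n` lies in the same affine
    -- space `M + D` as `w 1 - x n`.
    have hx'D : ∀ n, x' n + (w 1 - w 2) ∈ D := by
      intro n
      refine add_mem (Submodule.sum_mem _ fun i _ => Submodule.smul_mem _ _ ?_) ?_
      · have h1 : w (i + 2) - w 2 = f (i + 1) - f 1 := by simp [f]
        rw [h1]
        exact sub_mem (Submodule.le_topologicalClosure _ (Submodule.subset_span ⟨_, rfl⟩))
          (Submodule.le_topologicalClosure _ (Submodule.subset_span ⟨_, rfl⟩))
      · have h1 : w 1 - w 2 = -f 1 := by simp [f]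
        rw [h1]
        exact neg_mem (Submodule.le_topologicalClosure _ (Submodule.subset_span ⟨_, rfl⟩))
    have hshift : ∀ i j k l, ⟪w (i + 1) - w (j + 1), w (k + 1) - w (l + 1)⟫ =
        ⟪w i - w j, w k - w l⟫ := by
      intro i j k l
      simp only [inner_sub_left, inner_sub_right, hw]
    have hshift' : ∀ i k l, ⟪w (i + 1), w (k + 1) - w (l + 1)⟫ = ⟪w i, w k - w l⟫ := by
      intro i k l
      simp only [inner_sub_right, hw]
    have hxw : ∀ n i, ⟪w (i + 1), x' n⟫ = ⟪w i, x n⟫ := by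
      intro n i
      rw [← hc n]
      simp only [x', Finsupp.sum, inner_sum, inner_smul_right]
      exact Finset.sum_congr rfl fun j _ => by rw [hshift']
    have hxx : ∀ n, ⟪x' n, x' n⟫ = ⟪x n, x n⟫ := by
      intro n
      rw [← hc n]
      simp only [x', Finsupp.sum, inner_sum, inner_smul_right, sum_inner, inner_smul_left]
      exact Finset.sum_congr rfl fun j _ => by
        congr 1
        exact Finset.sum_congr rfl fun k _ => by rw [hshift]
    have hnorm : ∀ n, ‖w 2 - x' n‖ ^ 2 = ‖w 1 - x n‖ ^ 2 := by
      intro n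
      rw [← real_inner_self_eq_norm_sq, ← real_inner_self_eq_norm_sq]
      simp only [inner_sub_left, inner_sub_right, hxx]
      rw [real_inner_comm (w 2) (x' n), real_inner_comm (w 1) (x n), hxw, hw]
    have hlim : Tendsto (fun n => w 1 - x n) atTop (𝓝 M) := tendsto_const_nhds.sub hxd
    -- The shifted approximants have the norms of the original ones, which tend to the minimum ‖M‖;
    -- by Pythagoras they also converge to `M`.
    have hpyth : ∀ n, ‖(w 2 - x' n) - M‖ ^ 2 = ‖w 1 - x n‖ ^ 2 - ‖M‖ ^ 2 := by
      intro n
      have hmem : w 2 - x' n - M ∈ D := by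
        have : w 2 - x' n - M = d - (x' n + (w 1 - w 2)) := by simp only [M]; abel
        rw [this]
        exact sub_mem hd (hx'D n)
      have h1 := hMD _ hmem
      rw [← hnorm n]
      have h2 : w 2 - x' n = M + (w 2 - x' n - M) := by abel
      conv_rhs => rw [h2]
      rw [norm_add_sq_real, h1]
      ring
    have hlim' : Tendsto (fun n => w 2 - x' n) atTop (𝓝 M) := by
      rw [tendsto_iff_norm_sub_tendsto_zero]
      have h1 : Tendsto (fun n => ‖w 1 - x n‖ ^ 2 - ‖M‖ ^ 2) atTop (𝓝 0) := by
        rw [← sub_self (‖M‖ ^ 2)]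
        exact (hlim.norm.pow 2).sub_const (‖M‖ ^ 2)
      have h2 := (Real.continuous_sqrt.tendsto 0).comp h1
      rw [Real.sqrt_zero] at h2
      refine h2.congr fun n => ?_
      rw [Function.comp_apply, ← hpyth n, Real.sqrt_sq (norm_nonneg _)]
    have e1 : Tendsto (fun n => ⟪w 0, w 1 - x n⟫) atTop (𝓝 ⟪w 0, M⟫) :=
      tendsto_const_nhds.inner hlim
    have e2 : Tendsto (fun n => ⟪w 1, w 2 - x' n⟫) atTop (𝓝 ⟪w 1, M⟫) :=
      tendsto_const_nhds.inner hlim'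
    -- Stationarity equates the two sequences, hence their limits ⟪w 0, M⟫ and ⟪w 1, M⟫.
    have e3 : (fun n => ⟪w 1, w 2 - x' n⟫) = fun n => ⟪w 0, w 1 - x n⟫ := by
      ext n
      rw [inner_sub_right, inner_sub_right, hxw, hw]
    rw [e3] at e2
    rw [real_inner_comm, tendsto_nhds_unique e1 e2, real_inner_comm, hM1]
  · intro e c he
    have : ⟪e, d⟫ = 0 := inner_eq_zero_of_mem_closure_span (by
      rintro _ ⟨i, rfl⟩
      rw [inner_sub_right, he i, he 0, sub_self]) hd
    rw [inner_sub_right, he 0, this, sub_zero]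

/-- Linear prediction in a stationary sequence with mean is as good as affine prediction: the error
of the linear prediction is orthogonal to the constants `e`. -/
lemma inner_sub_starProjection_eq_zero_of_stationary [CompleteSpace H] {w : ℕ → H} {u e : H}
    {c : ℝ} (hw : ∀ i j, ⟪w (i + 1), w (j + 1)⟫ = ⟪w i, w j⟫)
    (hu : ∀ i, ⟪u, w (i + 1)⟫ = ⟪w 0, w (i + 1)⟫) (he : ∀ i, ⟪e, w (i + 1)⟫ = c)
    (heu : ⟪e, u⟫ = c) :
    haveI : CompleteSpace (Submodule.span ℝ (Set.range fun i => w (i + 1))).topologicalClosure :=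
      (Submodule.isClosed_topologicalClosure _).completeSpace_coe
    ⟪e, u - (Submodule.span ℝ
      (Set.range fun i => w (i + 1))).topologicalClosure.starProjection u⟫ = 0 := by
  obtain ⟨M, hMC, hMw, hMe⟩ := exists_mean_of_stationary hw
  set C := (Submodule.span ℝ (Set.range fun i => w (i + 1))).topologicalClosure with hC
  have : CompleteSpace C := (Submodule.isClosed_topologicalClosure _).completeSpace_coe
  change ⟪e, u - C.starProjection u⟫ = 0
  -- On `C`, pairing with `e` is proportional to pairing with `M`. As `M` lies in `C`, pairing with
  -- `M` does not distinguish `u` from its projection, so when `M ≠ 0` neither does pairing with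
  -- `e`.
  have hlin : ∀ x ∈ C, ⟪‖M‖ ^ 2 • e - c • M, x⟫ = 0 := fun x hx =>
    inner_eq_zero_of_mem_closure_span (by
      rintro _ ⟨i, rfl⟩
      rw [inner_sub_left, real_inner_smul_left, real_inner_smul_left, he, hMw]
      ring) hx
  have heM : ⟪e, M⟫ = c := hMe e c he
  have huM : ⟪u, M⟫ = ‖M‖ ^ 2 := by
    have h1 : ⟪u - w 0, M⟫ = 0 := inner_eq_zero_of_mem_closure_span (by
      rintro _ ⟨i, rfl⟩
      rw [inner_sub_left, hu, sub_self]) hMC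
    rw [inner_sub_left, real_inner_comm M (w 0), hMw] at h1
    linarith
  have hW : ⟪M, C.starProjection u⟫ = ‖M‖ ^ 2 := by
    have := Submodule.inner_right_of_mem_orthogonal hMC
      (Submodule.sub_starProjection_mem_orthogonal (K := C) u)
    rw [inner_sub_right, real_inner_comm, huM] at this
    linarith
  have h2 := hlin _ (Submodule.starProjection_apply_mem C u)
  rw [inner_sub_left, real_inner_smul_left, real_inner_smul_left, hW] at h2
  rw [inner_sub_right, heu]
  -- If `M = 0`, the proportionality says nothing, but then `c = ⟪e, M⟫ = 0` and `e` is orthogonal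
  -- to all of `C`.
  by_cases hM0 : ‖M‖ = 0
  · have hM : M = 0 := norm_eq_zero.1 hM0
    have hc : c = 0 := by rw [← heM, hM, inner_zero_right]
    have : ⟪e, C.starProjection u⟫ = 0 := inner_eq_zero_of_mem_closure_span (by
      rintro _ ⟨i, rfl⟩
      rw [he, hc]) (Submodule.starProjection_apply_mem C u)
    rw [hc, this, sub_zero]
  · have h3 : ‖M‖ ^ 2 * (c - ⟪e, C.starProjection u⟫) = 0 := by linarith
    exact (mul_eq_zero.1 h3).resolve_left (pow_ne_zero 2 hM0)

end Hilbert

/-! ### Random variables as vectors of L². -/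

lemma inner_toLp_eq_integral {Ω : Type*} [MeasurableSpace Ω] {P : Measure Ω} {f g : Ω → ℝ}
    (hf : MemLp f 2 P) (hg : MemLp g 2 P) : ⟪hf.toLp f, hg.toLp g⟫ = ∫ ω, f ω * g ω ∂P := by
  rw [L2.inner_def]
  refine integral_congr_ae ?_
  filter_upwards [hf.coeFn_toLp, hg.coeFn_toLp] with ω h1 h2
  rw [h1, h2]
  exact mul_comm _ _

lemma toLp_sum_const_mul {Ω ι : Type*} [MeasurableSpace Ω] {P : Measure Ω} {f : ι → Ω → ℝ}
    (hf : ∀ i, MemLp (f i) 2 P) (b : ι → ℝ) (s : Finset ι) :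
    (memLp_finsetSum s fun i _ => (hf i).const_mul (b i)).toLp =
      ∑ i ∈ s, b i • (hf i).toLp := by
  classical
  induction s using Finset.induction_on with
  | empty => simp only [Finset.sum_empty]; rfl
  | insert i s hi ih =>
    rw [Finset.sum_insert hi, ← ih]
    simp only [Finset.sum_insert hi]
    rfl

lemma meanSqError_eq_ofReal_norm_sq {Ω : Type*} [MeasurableSpace Ω] {P : Measure Ω} {f g : Ω → ℝ}
    (hf : MemLp f 2 P) (hg : MemLp g 2 P) :
    meanSqError P f g = ENNReal.ofReal (‖hf.toLp f - hg.toLp g‖ ^ 2) := by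
  rw [meanSqError, ← MemLp.toLp_sub hf hg, ← real_inner_self_eq_norm_sq, inner_toLp_eq_integral,
    ofReal_integral_eq_lintegral_ofReal]
  · simp only [Pi.sub_apply, pow_two]
  · simpa only [pow_two] using (hf.sub hg).integrable_sq
  · exact Eventually.of_forall fun ω => mul_self_nonneg _

/-! ### Second moments and joint stationarity of the channel. -/

/-- The input `U`, the noise `N` and the output `V = U + N` of an additive white Gaussian noise
channel with stationary Gaussian input. -/
structure IsGaussianChannel {Ω : Type*} [MeasurableSpace Ω] (P : Measure Ω) (θ : ℝ≥0)
    (U N V : ℤ → Ω → ℝ) : Prop where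
  measurable_input : ∀ n, Measurable (U n)
  measurable_noise : ∀ n, Measurable (N n)
  gaussian : IsGaussianProcess U P
  stationary : IsStationaryProcess P U
  noise : IsWhiteGaussianNoise P N θ
  indep : IndepFun (fun ω n => U n ω) (fun ω n => N n ω) P
  output : ∀ n, V n = U n + N n

/-- The error of the affine prediction of `U n` from `V (n - 1), …, V (n - L)` with coefficients
`a` and constant term `c`. -/
def affineResidual {Ω : Type*} (U V : ℤ → Ω → ℝ) (a : ℕ → ℝ) (c : ℝ) (n : ℤ) (L : ℕ) (ω : Ω) : ℝ :=
  U n ω - (∑ i ∈ Finset.range L, a i * V (n - ((i : ℤ) + 1)) ω + c)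

namespace IsGaussianChannel

variable {Ω : Type*} [MeasurableSpace Ω] {P : Measure Ω} {θ : ℝ≥0}
  {U N V : ℤ → Ω → ℝ}

lemma measurable_output (h : IsGaussianChannel P θ U N V) (n : ℤ) : Measurable (V n) := by
  rw [h.output]
  exact (h.measurable_input n).add (h.measurable_noise n)

lemma hasGaussianLaw_noise (h : IsGaussianChannel P θ U N V) (n : ℤ) : HasGaussianLaw (N n) P :=
  (h.noise.hasLaw n).hasGaussianLaw

lemma memLp_input (h : IsGaussianChannel P θ U N V) (n : ℤ) : MemLp (U n) 2 P :=
  (h.gaussian.hasGaussianLaw_eval n).memLp_two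

lemma memLp_noise (h : IsGaussianChannel P θ U N V) (n : ℤ) : MemLp (N n) 2 P :=
  (h.hasGaussianLaw_noise n).memLp_two

lemma memLp_output (h : IsGaussianChannel P θ U N V) (n : ℤ) : MemLp (V n) 2 P := by
  rw [h.output]
  exact (h.memLp_input n).add (h.memLp_noise n)

lemma isGaussianProcess_sumElim (h : IsGaussianChannel P θ U N V) :
    IsGaussianProcess (Sum.elim U N) P :=
  _root_.isGaussianProcess_sumElim h.gaussian
    (isGaussianProcess_of_iIndepFun h.hasGaussianLaw_noise h.noise.iIndepFun) h.indep

lemma integral_noise (h : IsGaussianChannel P θ U N V) (n : ℤ) : ∫ ω, N n ω ∂P = 0 := by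
  rw [(h.noise.hasLaw n).integral_eq, integral_id_gaussianReal]

lemma variance_noise (h : IsGaussianChannel P θ U N V) (n : ℤ) : Var[N n; P] = θ := by
  rw [(h.noise.hasLaw n).variance_eq, variance_id_gaussianReal]

lemma covariance_noise_input (h : IsGaussianChannel P θ U N V) (m n : ℤ) :
    cov[N m, U n; P] = 0 := by
  rw [covariance_comm]
  exact (h.indep.comp (measurable_pi_apply n) (measurable_pi_apply m)).covariance_eq_zero
    (h.memLp_input n) (h.memLp_noise m)

lemma covariance_noise_output [IsProbabilityMeasure P] (h : IsGaussianChannel P θ U N V)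
    {m n : ℤ} (hmn : m ≠ n) :
    cov[N m, V n; P] = 0 := by
  rw [h.output, covariance_add_right (h.memLp_noise m) (h.memLp_input n) (h.memLp_noise n),
    h.covariance_noise_input, zero_add]
  exact (h.noise.iIndepFun.indepFun hmn).covariance_eq_zero (h.memLp_noise m) (h.memLp_noise n)

lemma integral_noise_mul_output [IsProbabilityMeasure P] (h : IsGaussianChannel P θ U N V)
    {m n : ℤ} (hmn : m ≠ n) :
    ∫ ω, N m ω * V n ω ∂P = 0 := by
  have := covariance_eq_sub (h.memLp_noise m) (h.memLp_output n)
  rw [h.covariance_noise_output hmn, h.integral_noise, zero_mul, sub_zero] at this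
  exact this.symm

lemma integral_output (h : IsGaussianChannel P θ U N V) (n : ℤ) :
    ∫ ω, V n ω ∂P = ∫ ω, U n ω ∂P := by
  have hU := (h.gaussian.hasGaussianLaw_eval n).integrable
  have hN := (h.hasGaussianLaw_noise n).integrable
  rw [h.output]
  simp only [Pi.add_apply]
  rw [integral_add hU hN, h.integral_noise, add_zero]

/-- The input and the output are jointly stationary. -/
lemma identDistrib_shift [IsProbabilityMeasure P] (h : IsGaussianChannel P θ U N V)
    (k : ℤ) :
    IdentDistrib (fun ω (n : ℤ) => (U (n + k) ω, V (n + k) ω)) (fun ω (n : ℤ) => (U n ω, V n ω))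
      P P := by
  have hN : IdentDistrib (fun ω (n : ℤ) => N (n + k) ω) (fun ω (n : ℤ) => N n ω) P P :=
    IdentDistrib.pi (fun n => ⟨(h.measurable_noise _).aemeasurable,
        (h.measurable_noise _).aemeasurable, by
          rw [(h.noise.hasLaw _).map_eq, (h.noise.hasLaw _).map_eq]⟩)
      (h.noise.iIndepFun.precomp (add_left_injective k)) h.noise.iIndepFun
  have hUN : IndepFun (fun ω (n : ℤ) => U (n + k) ω) (fun ω (n : ℤ) => N (n + k) ω) P :=
    h.indep.comp (φ := fun (x : ℤ → ℝ) (n : ℤ) => x (n + k))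
      (ψ := fun (x : ℤ → ℝ) (n : ℤ) => x (n + k)) (by fun_prop) (by fun_prop)
  have := ((h.stationary k).prodMk hN hUN h.indep).comp
    (u := fun z (n : ℤ) => (z.1 n, z.1 n + z.2 n)) (by fun_prop)
  simp only [h.output]
  exact this

lemma identDistrib_shift_comp [IsProbabilityMeasure P] (h : IsGaussianChannel P θ U N V)
    {γ : Type*} [MeasurableSpace γ]
    {F : (ℤ → ℝ × ℝ) → γ} (hF : Measurable F) (m n : ℤ) :
    IdentDistrib (fun ω => F fun k => (U (k + m) ω, V (k + m) ω))
      (fun ω => F fun k => (U (k + n) ω, V (k + n) ω)) P P :=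
  ((h.identDistrib_shift m).comp hF).trans ((h.identDistrib_shift n).comp hF).symm

lemma integral_output_eq [IsProbabilityMeasure P] (h : IsGaussianChannel P θ U N V)
    (m n : ℤ) :
    ∫ ω, V m ω ∂P = ∫ ω, V n ω ∂P := by
  have := (h.identDistrib_shift_comp (F := fun z => (z 0).2) (by fun_prop) m n).integral_eq
  simpa using this

lemma integral_output_mul_output [IsProbabilityMeasure P] (h : IsGaussianChannel P θ U N V)
    {i j k l : ℤ}
    (hij : i - j = k - l) :
    ∫ ω, V i ω * V j ω ∂P = ∫ ω, V k ω * V l ω ∂P := by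
  have := (h.identDistrib_shift_comp (F := fun z => (z (i - j)).2 * (z 0).2) (by fun_prop)
    j l).integral_eq
  have hk : i - j + l = k := by omega
  simpa [hk] using this

/-- The noise at time `m` is centred and uncorrelated with the output at other times. For linear
prediction from the past, the targets U_n and V_n are therefore indistinguishable, which lets V_n
play the role of `w 0` in the Hilbert space lemmas. -/
lemma integral_input_mul_output [IsProbabilityMeasure P] (h : IsGaussianChannel P θ U N V)
    {m n : ℤ} (hmn : m ≠ n) :
    ∫ ω, U m ω * V n ω ∂P = ∫ ω, V m ω * V n ω ∂P := by
  rw [h.output m]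
  simp only [Pi.add_apply, add_mul]
  have := integral_add ((h.memLp_input m).integrable_mul (h.memLp_output n))
    ((h.memLp_noise m).integrable_mul (h.memLp_output n))
  simp only [Pi.mul_apply] at this
  rw [this, h.integral_noise_mul_output hmn, add_zero]

lemma memLp_affineResidual [IsProbabilityMeasure P] (h : IsGaussianChannel P θ U N V)
    (a : ℕ → ℝ) (c : ℝ) (n : ℤ)
    (L : ℕ) : MemLp (affineResidual U V a c n L) 2 P :=
  (h.memLp_input n).sub ((memLp_finsetSum _ fun _ _ => (h.memLp_output _).const_mul _).add
    (memLp_const c))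

lemma measurable_affineResidual (h : IsGaussianChannel P θ U N V) (a : ℕ → ℝ) (c : ℝ) (n : ℤ)
    (L : ℕ) : Measurable (affineResidual U V a c n L) :=
  (h.measurable_input n).sub ((Finset.measurable_sum _ fun _ _ =>
    (h.measurable_output _).const_mul _).add_const c)

/-- The error of a given affine prediction, jointly with the output, is stationary. -/
lemma identDistrib_affineResidual [IsProbabilityMeasure P] (h : IsGaussianChannel P θ U N V)
    (a : ℕ → ℝ) (c : ℝ) (L : ℕ)
    (k m n : ℤ) :
    IdentDistrib (fun ω => (affineResidual U V a c m L ω, V (k + m) ω))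
      (fun ω => (affineResidual U V a c n L ω, V (k + n) ω)) P P := by
  have := h.identDistrib_shift_comp (F := fun z => ((z 0).1 -
    (∑ i ∈ Finset.range L, a i * (z (-((i : ℤ) + 1))).2 + c), (z k).2)) (by fun_prop) m n
  simpa only [affineResidual, zero_add, neg_add_eq_sub] using this

end IsGaussianChannel

/-! ### Affine prediction of finite order. -/

lemma mem_span_sumElim_inl {Ω : Type*} (U N : ℤ → Ω → ℝ) (n : ℤ) :
    U n ∈ Submodule.span ℝ (Set.range (Sum.elim U N)) :=
  Submodule.subset_span ⟨.inl n, rfl⟩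

lemma mem_span_sumElim_inr {Ω : Type*} (U N : ℤ → Ω → ℝ) (n : ℤ) :
    N n ∈ Submodule.span ℝ (Set.range (Sum.elim U N)) :=
  Submodule.subset_span ⟨.inr n, rfl⟩

/-- A random variable that is Gaussian up to an additive constant is Gaussian. -/
lemma hasGaussianLaw_of_add_const {Ω : Type*} [MeasurableSpace Ω] {P : Measure Ω} {X : Ω → ℝ}
    (hX : Measurable X) {c : ℝ} (h : HasGaussianLaw (fun ω => X ω + c) P) :
    HasGaussianLaw X P := by
  have := h.isGaussian_map
  constructor
  have h1 : P.map X = (P.map fun ω => X ω + c).map (fun x => x + -c) := by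
    rw [Measure.map_map (by fun_prop) (hX.add_const c)]
    congr 1
    ext ω
    simp
  rw [h1]
  infer_instance

namespace IsGaussianChannel

variable {Ω : Type*} [MeasurableSpace Ω] {P : Measure Ω} {θ : ℝ≥0}
  {U N V : ℤ → Ω → ℝ}

lemma output_mem_span (h : IsGaussianChannel P θ U N V) (n : ℤ) :
    V n ∈ Submodule.span ℝ (Set.range (Sum.elim U N)) := by
  rw [h.output]
  exact add_mem (mem_span_sumElim_inl U N n) (mem_span_sumElim_inr U N n)

/-- Constants need not lie in the span of `U` and `N`. Joint Gaussianity is therefore proved with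
the intercept added back, and the shift is undone afterwards. -/
lemma affineResidual_add_const_mem_span (h : IsGaussianChannel P θ U N V) (a : ℕ → ℝ) (c : ℝ)
    (n : ℤ) (L : ℕ) :
    (fun ω => affineResidual U V a c n L ω + c) ∈
      Submodule.span ℝ (Set.range (Sum.elim U N)) := by
  have : (fun ω => affineResidual U V a c n L ω + c) =
      U n - ∑ i ∈ Finset.range L, a i • V (n - ((i : ℤ) + 1)) := by
    ext ω
    simp only [affineResidual, Pi.sub_apply, Finset.sum_apply, Pi.smul_apply, smul_eq_mul]
    ring
  rw [this]
  exact sub_mem (mem_span_sumElim_inl U N n)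
    (Submodule.sum_mem _ fun i _ => Submodule.smul_mem _ _ (h.output_mem_span _))

lemma hasLaw_affineResidual (h : IsGaussianChannel P θ U N V) {a : ℕ → ℝ} {c : ℝ} {n : ℤ} {L : ℕ}
    (h0 : ∫ ω, affineResidual U V a c n L ω ∂P = 0) :
    HasLaw (affineResidual U V a c n L)
      (gaussianReal 0 Var[affineResidual U V a c n L; P].toNNReal) P := by
  have hG := (isGaussianProcess_of_mem_span (Y := fun _ : Unit => fun ω =>
    affineResidual U V a c n L ω + c) h.isGaussianProcess_sumElim
    fun _ => h.affineResidual_add_const_mem_span a c n L).hasGaussianLaw_eval ()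
  have hR : HasGaussianLaw (affineResidual U V a c n L) P :=
    hasGaussianLaw_of_add_const (h.measurable_affineResidual a c n L) hG
  refine ⟨hR.aemeasurable, ?_⟩
  rw [hR.map_eq_gaussianReal, h0]

/-- The error of an affine prediction that is uncorrelated with the regressors is independent of
them. -/
lemma indepFun_affineResidual (h : IsGaussianChannel P θ U N V) {a : ℕ → ℝ} {c : ℝ} {n : ℤ} {L : ℕ}
    (hcov : ∀ i < L, cov[affineResidual U V a c n L, V (n - ((i : ℤ) + 1)); P] = 0) :
    IndepFun (affineResidual U V a c n L) (fun ω (i : Fin L) => V (n - ((i : ℤ) + 1)) ω) P := by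
  have : IsProbabilityMeasure P := h.gaussian.isProbabilityMeasure
  have hG := isGaussianProcess_of_mem_span (Y := Sum.elim
    (fun (_ : Unit) ω => affineResidual U V a c n L ω + c)
    (fun (i : Fin L) => V (n - ((i : ℤ) + 1)))) h.isGaussianProcess_sumElim (by
      rintro (_ | i)
      · exact h.affineResidual_add_const_mem_span a c n L
      · exact h.output_mem_span _)
  have hind := hG.indepFun_of_covariance_eq_zero
    (fun _ => ((h.measurable_affineResidual a c n L).add_const c).aemeasurable)
    (fun i => (h.measurable_output _).aemeasurable) (by
      intro _ i
      rw [covariance_add_const_left ((h.memLp_affineResidual a c n L).integrable one_le_two)]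
      exact hcov i i.2)
  have := hind.comp (φ := fun x : Unit → ℝ => x () - c) (ψ := id) (by fun_prop) measurable_id
  convert! this using 1
  ext ω
  simp

/-- The optimum affine predictors of `U n` of all orders, and the limit `r` of their errors. -/
lemma exists_affinePredictor [IsProbabilityMeasure P] (h : IsGaussianChannel P θ U N V)
    (n : ℤ) :
    ∃ (a : ℕ → ℕ → ℝ) (c : ℕ → ℝ) (r : Lp ℝ 2 P),
      (∀ L, ∫ ω, affineResidual U V (a L) (c L) n L ω ∂P = 0) ∧
      (∀ L, ∀ i < L, cov[affineResidual U V (a L) (c L) n L, V (n - ((i : ℤ) + 1)); P] = 0) ∧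
      Tendsto (fun L => (h.memLp_affineResidual (a L) (c L) n L).toLp) atTop (𝓝 r) ∧
      (h.memLp_input n).toLp - r ∈ (Submodule.span ℝ (insert ((memLp_const 1).toLp)
        (Set.range fun i : ℕ =>
          (h.memLp_output (n - ((i : ℤ) + 1))).toLp))).topologicalClosure ∧
      ⟪(memLp_const (1 : ℝ)).toLp, r⟫ = 0 ∧
      ∀ i : ℕ, ⟪(h.memLp_output (n - ((i : ℤ) + 1))).toLp, r⟫ = 0 := by
  set u : Lp ℝ 2 P := (h.memLp_input n).toLp with hu
  set v : ℕ → Lp ℝ 2 P := fun i => (h.memLp_output (n - ((i : ℤ) + 1))).toLp with hv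
  set e : Lp ℝ 2 P := (memLp_const (1 : ℝ)).toLp with he
  let S : ℕ → Submodule ℝ (Lp ℝ 2 P) := fun L =>
    Submodule.span ℝ (insert e (v '' (Finset.range L : Set ℕ)))
  have hSfin : ∀ L, FiniteDimensional ℝ (S L) := fun L =>
    FiniteDimensional.span_of_finite ℝ (((Finset.range L).finite_toSet.image v).insert e)
  have hSmono : Monotone S := fun L L' hL => Submodule.span_mono
    (Set.insert_subset_insert (Set.image_mono (by simpa using hL)))
  have hSsup : ⨆ L, S L = Submodule.span ℝ (insert e (Set.range v)) := by
    rw [← Submodule.span_iUnion]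
    congr 1
    ext x
    simp only [Set.mem_iUnion, Set.mem_insert_iff, Set.mem_image, Set.mem_range, Finset.coe_range,
      Set.mem_Iio]
    constructor
    · rintro ⟨L, hx | ⟨i, -, hx⟩⟩
      · exact .inl hx
      · exact .inr ⟨i, hx⟩
    · rintro (hx | ⟨i, hx⟩)
      · exact ⟨0, .inl hx⟩
      · exact ⟨i + 1, .inr ⟨i, Nat.lt_succ_self i, hx⟩⟩
  have hcoef : ∀ L, ∃ (a : ℕ → ℝ) (c : ℝ),
      (S L).starProjection u = ∑ i ∈ Finset.range L, a i • v i + c • e := by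
    intro L
    obtain ⟨c, z, hz, hx⟩ := Submodule.mem_span_insert.1
      (Submodule.starProjection_apply_mem (S L) u)
    obtain ⟨a, ha⟩ := (Submodule.mem_span_image_finset_iff_exists_fun' ℝ).1 hz
    exact ⟨a, c, by rw [hx, ha, add_comm]⟩
  choose a c hac using hcoef
  have hres : ∀ L, (h.memLp_affineResidual (a L) (c L) n L).toLp =
      u - (S L).starProjection u := by
    intro L
    rw [hac L]
    rw [← toLp_sum_const_mul (fun i : ℕ => h.memLp_output (n - ((i : ℤ) + 1))) (a L)
      (Finset.range L)]
    have hconst : c L • e = (memLp_const (μ := P) (p := 2) (c L)).toLp := by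
      rw [he, ← MemLp.toLp_const_smul]
      congr 1
      ext ω
      simp
    rw [hconst]
    rfl
  have horth : ∀ L, ∀ x ∈ S L, ⟪x, (h.memLp_affineResidual (a L) (c L) n L).toLp⟫ = 0 := by
    intro L x hx
    rw [hres]
    exact Submodule.inner_right_of_mem_orthogonal hx
      (Submodule.sub_starProjection_mem_orthogonal (K := S L) u)
  have hmean : ∀ L, ∫ ω, affineResidual U V (a L) (c L) n L ω ∂P = 0 := by
    intro L
    have := horth L e (Submodule.subset_span (Set.mem_insert _ _))
    rw [he, inner_toLp_eq_integral] at this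
    simpa using this
  have hcl : (⨆ L, S L).topologicalClosure.HasOrthogonalProjection := by
    have : CompleteSpace (⨆ L, S L).topologicalClosure :=
      (Submodule.isClosed_topologicalClosure _).completeSpace_coe
    infer_instance
  refine ⟨a, c, u - (⨆ L, S L).topologicalClosure.starProjection u, hmean, ?_, ?_, ?_, ?_, ?_⟩
  · intro L i hi
    have := horth L (v i) (Submodule.subset_span
      (Set.mem_insert_of_mem _ ⟨i, by simpa using hi, rfl⟩))
    rw [hv, inner_toLp_eq_integral] at this
    rw [covariance_comm, covariance_eq_sub (h.memLp_output _) (h.memLp_affineResidual _ _ _ _),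
      hmean, mul_zero, sub_zero]
    exact this
  · simp only [hres]
    exact tendsto_const_nhds.sub (Submodule.starProjection_tendsto_closure_iSup S hSmono u)
  · rw [sub_sub_cancel, ← hSsup]
    exact Submodule.starProjection_apply_mem _ _
  · refine Submodule.inner_right_of_mem_orthogonal ?_
      (Submodule.sub_starProjection_mem_orthogonal (K := (⨆ L, S L).topologicalClosure) u)
    refine Submodule.le_topologicalClosure _ (hSsup ▸ Submodule.subset_span (Set.mem_insert _ _))
  · intro i
    refine Submodule.inner_right_of_mem_orthogonal ?_
      (Submodule.sub_starProjection_mem_orthogonal (K := (⨆ L, S L).topologicalClosure) u)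
    refine Submodule.le_topologicalClosure _ (hSsup ▸ Submodule.subset_span
      (Set.mem_insert_of_mem _ ⟨i, rfl⟩))

end IsGaussianChannel

/-! ### Prediction from the infinite past. -/

/-- An `L²` limit of centred Gaussian variables is a centred Gaussian variable. -/
lemma hasLaw_gaussianReal_of_tendsto {Ω : Type*} [MeasurableSpace Ω] {P : Measure Ω}
    [IsProbabilityMeasure P] {X : ℕ → Ω → ℝ} {Y : Ω → ℝ} {v : ℕ → ℝ≥0} {w : ℝ≥0}
    (hX : ∀ n, HasLaw (X n) (gaussianReal 0 (v n)) P) (hv : Tendsto v atTop (𝓝 w))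
    (hXY : TendstoInMeasure P X atTop Y) : HasLaw Y (gaussianReal 0 w) P := by
  have hd := hXY.tendstoInDistribution fun n => (hX n).aemeasurable
  have hYm := hd.aemeasurable_limit
  refine ⟨hYm, ?_⟩
  have := Measure.isProbabilityMeasure_map (μ := P) hYm
  -- Characteristic functions converge both to that of `Y` and, by convergence of the variances, to
  -- that of N(0, w).
  refine Measure.ext_of_charFun (funext fun t => ?_)
  have h1 := ProbabilityMeasure.tendsto_iff_tendsto_charFun.1 hd.tendsto t
  simp only [ProbabilityMeasure.coe_mk, fun n => (hX n).map_eq, charFun_gaussianReal] at h1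
  refine tendsto_nhds_unique h1 ?_
  rw [charFun_gaussianReal]
  have hv' : Tendsto (fun n => (((v n : ℝ≥0) : ℝ) : ℂ)) atTop (𝓝 ((w : ℝ) : ℂ)) :=
    (Complex.continuous_ofReal.tendsto _).comp ((NNReal.continuous_coe.tendsto _).comp hv)
  exact ((tendsto_const_nhds.sub ((hv'.mul_const _).div_const _)).cexp)

lemma measurable_infinitePast {Ω : Type*} {mΩ : MeasurableSpace Ω} {V : ℤ → Ω → ℝ} {n : ℤ}
    (hV : ∀ i : ℕ, Measurable (V (n - ((i : ℤ) + 1)))) : Measurable (infinitePast V n) :=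
  measurable_pi_iff.2 hV

/-- The filtration of the σ-algebras of `V (n - 1), …, V (n - L)`. -/
def pastFiltration {Ω : Type*} [mΩ : MeasurableSpace Ω] (V : ℤ → Ω → ℝ)
    (hV : ∀ n, Measurable (V n)) (n : ℤ) : Filtration ℕ mΩ where
  seq L := MeasurableSpace.comap (fun ω (i : Fin L) => V (n - ((i : ℤ) + 1)) ω) inferInstance
  mono' L L' hL := by
    have h : (fun ω (i : Fin L) => V (n - ((i : ℤ) + 1)) ω) =
        (fun (x : Fin L' → ℝ) (i : Fin L) => x (Fin.castLE hL i)) ∘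
          fun ω (i : Fin L') => V (n - ((i : ℤ) + 1)) ω := rfl
    change MeasurableSpace.comap _ _ ≤ MeasurableSpace.comap _ _
    rw [h, ← MeasurableSpace.comap_comp]
    exact MeasurableSpace.comap_mono (Measurable.comap_le (by fun_prop))
  le' L := (measurable_pi_iff.2 fun _ => hV _).comap_le

namespace IsGaussianChannel

variable {Ω : Type*} [mΩ : MeasurableSpace Ω] {P : Measure Ω} {θ : ℝ≥0}
  {U N V : ℤ → Ω → ℝ}

/-- The optimum affine predictors are conditional expectations. -/
lemma condExp_input_ae_eq (h : IsGaussianChannel P θ U N V) {a : ℕ → ℝ} {c : ℝ} {n : ℤ} {L : ℕ}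
    (h0 : ∫ ω, affineResidual U V a c n L ω ∂P = 0)
    (hcov : ∀ i < L, cov[affineResidual U V a c n L, V (n - ((i : ℤ) + 1)); P] = 0) :
    P[U n | pastFiltration V h.measurable_output n L] =ᵐ[P]
      fun ω => U n ω - affineResidual U V a c n L ω := by
  have : IsProbabilityMeasure P := h.gaussian.isProbabilityMeasure
  set R := affineResidual U V a c n L with hR
  set F := pastFiltration V h.measurable_output n with hF
  have hRint : Integrable R P := (h.memLp_affineResidual a c n L).integrable one_le_two
  have hUint : Integrable (U n) P := (h.memLp_input n).integrable one_le_two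
  have hpred : StronglyMeasurable[F L] fun ω => U n ω - R ω := by
    have h1 : (fun ω => U n ω - R ω) =
        (fun x : Fin L → ℝ => ∑ i : Fin L, a i * x i + c) ∘
          fun ω (i : Fin L) => V (n - ((i : ℤ) + 1)) ω := by
      ext ω
      simp only [hR, affineResidual, Function.comp_apply, sub_sub_cancel]
      rw [Finset.sum_range]
    have h2 : Measurable fun x : Fin L → ℝ => ∑ i : Fin L, a i * x i + c := by fun_prop
    rw [h1]
    exact (h2.comp (comap_measurable _)).stronglyMeasurable
  -- Uncorrelated and jointly Gaussian, hence independent: conditioning leaves only the mean.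
  have hR0 : P[R | F L] =ᵐ[P] fun _ => 0 := by
    have hmR := (h.measurable_affineResidual a c n L)
    have := condExp_indep_eq (μ := P) hmR.comap_le (F.le L)
      (comap_measurable R).stronglyMeasurable (h.indepFun_affineResidual hcov)
    rwa [h0] at this
  have hsum : U n = (fun ω => U n ω - R ω) + R := by
    ext ω
    simp
  have h3 := condExp_add (hUint.sub hRint) hRint (F L)
  have h4 : P[fun ω => U n ω - R ω | F L] = fun ω => U n ω - R ω :=
    condExp_of_stronglyMeasurable (F.le L) hpred (hUint.sub hRint)
  have h5 : P[U n | F L] =ᵐ[P] P[fun ω => U n ω - R ω | F L] + P[R | F L] := by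
    conv_lhs => rw [hsum]
    exact h3
  filter_upwards [h5, hR0] with ω h6 h7
  rw [h6, Pi.add_apply, h7, h4, add_zero]

/-- The limit of the errors of the optimum affine predictors is orthogonal to all functions of the
infinite past. -/
lemma inner_toLp_comp_infinitePast_eq_zero [IsProbabilityMeasure P]
    (h : IsGaussianChannel P θ U N V) {n : ℤ}
    {a : ℕ → ℕ → ℝ} {c : ℕ → ℝ} {r : Lp ℝ 2 P}
    (h0 : ∀ L, ∫ ω, affineResidual U V (a L) (c L) n L ω ∂P = 0)
    (hcov : ∀ L, ∀ i < L,
      cov[affineResidual U V (a L) (c L) n L, V (n - ((i : ℤ) + 1)); P] = 0)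
    (hr : Tendsto (fun L => (h.memLp_affineResidual (a L) (c L) n L).toLp) atTop (𝓝 r))
    {k : (ℕ → ℝ) → ℝ} (hk : Measurable k)
    (hk2 : MemLp (fun ω => k (infinitePast V n ω)) 2 P) :
    ⟪r, hk2.toLp⟫ = 0 := by
  set F := pastFiltration V h.measurable_output n with hF
  set u : Lp ℝ 2 P := (h.memLp_input n).toLp with hu
  have hFle : ⨆ L, F L ≤ mΩ := iSup_le fun L => F.le L
  have hkm : StronglyMeasurable[⨆ L, F L] fun ω => k (infinitePast V n ω) := by
    refine (hk.comp (measurable_infinitePast (mΩ := ⨆ L, F L) fun i => ?_)).stronglyMeasurable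
    refine Measurable.mono ?_ (le_iSup (fun L => F L) (i + 1)) le_rfl
    exact (measurable_pi_apply (⟨i, Nat.lt_succ_self i⟩ : Fin (i + 1))).comp
      (comap_measurable fun ω (i : Fin (_ + 1)) => V (n - ((i : ℤ) + 1)) ω)
  -- the predictors tend to `u - r` and, by Lévy's theorem, to a conditional expectation
  have hlim1 : TendstoInMeasure P (fun L => P[U n | F L]) atTop (u - r : Lp ℝ 2 P) := by
    have h1 : Tendsto (fun L => u - (h.memLp_affineResidual (a L) (c L) n L).toLp) atTop
      (𝓝 (u - r)) := tendsto_const_nhds.sub hr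
    refine (tendstoInMeasure_of_tendsto_Lp h1).congr (fun L => ?_) EventuallyEq.rfl
    filter_upwards [h.condExp_input_ae_eq (h0 L) (hcov L), Lp.coeFn_sub u
      (h.memLp_affineResidual (a L) (c L) n L).toLp, (h.memLp_input n).coeFn_toLp,
      (h.memLp_affineResidual (a L) (c L) n L).coeFn_toLp] with ω h2 h3 h4 h5
    rw [h2, h3, Pi.sub_apply, h4, h5]
  have hlim2 : TendstoInMeasure P (fun L => P[U n | F L]) atTop (P[U n | ⨆ L, F L]) :=
    tendstoInMeasure_of_tendsto_eLpNorm one_ne_zero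
      (fun L => (stronglyMeasurable_condExp.mono (F.le L)).aestronglyMeasurable)
      (stronglyMeasurable_condExp.mono hFle).aestronglyMeasurable (tendsto_eLpNorm_condExp (U n))
  have hlim : P[U n | ⨆ L, F L] =ᵐ[P] (u - r : Lp ℝ 2 P) := tendstoInMeasure_ae_unique hlim2 hlim1
  have hint : Integrable (U n * fun ω => k (infinitePast V n ω)) P :=
    (h.memLp_input n).integrable_mul hk2
  have hpull := condExp_mul_of_aestronglyMeasurable_right (μ := P) hkm.aestronglyMeasurable hint
    ((h.memLp_input n).integrable one_le_two)
  -- Since `u - r` is the conditional expectation, the past-measurable factor can be pulled out and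
  -- the expectations agree.
  have hinner : ⟪u - r, hk2.toLp⟫ = ⟪u, hk2.toLp⟫ := by
    rw [hu, inner_toLp_eq_integral, ← hu, L2.inner_def]
    have h1 := integral_condExp (μ := P) (f := U n * fun ω => k (infinitePast V n ω)) hFle
    rw [integral_congr_ae hpull] at h1
    simp only [Pi.mul_apply] at h1
    rw [← h1]
    refine integral_congr_ae ?_
    filter_upwards [hlim, hk2.coeFn_toLp] with ω h2 h3
    rw [h2, h3]
    exact mul_comm _ _
  rw [inner_sub_left] at hinner
  linarith

/-- The error of the optimum predictor from the infinite past is the limit of the errors of the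
optimum affine predictors. -/
lemma error_ae_eq [IsProbabilityMeasure P]
    (h : IsGaussianChannel P θ U N V) {n : ℤ}
    {a : ℕ → ℕ → ℝ} {c : ℕ → ℝ} {r : Lp ℝ 2 P}
    (h0 : ∀ L, ∫ ω, affineResidual U V (a L) (c L) n L ω ∂P = 0)
    (hcov : ∀ L, ∀ i < L,
      cov[affineResidual U V (a L) (c L) n L, V (n - ((i : ℤ) + 1)); P] = 0)
    (hr : Tendsto (fun L => (h.memLp_affineResidual (a L) (c L) n L).toLp) atTop (𝓝 r))
    {g : (ℕ → ℝ) → ℝ} (hg : IsOptimalPredictor P U V n g) :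
    (fun ω => U n ω - g (infinitePast V n ω)) =ᵐ[P] r := by
  have hpm : Measurable (infinitePast V n) := measurable_infinitePast fun i => h.measurable_output _
  -- the predictor output is square integrable
  have hZ2 : MemLp (fun ω => U n ω - g (infinitePast V n ω)) 2 P := by
    have hm : Measurable fun ω => U n ω - g (infinitePast V n ω) :=
      (h.measurable_input n).sub (hg.measurable.comp hpm)
    rw [memLp_two_iff_integrable_sq hm.aestronglyMeasurable]
    refine ⟨(hm.pow_const 2).aestronglyMeasurable, ?_⟩
    rw [hasFiniteIntegral_iff_ofReal (Eventually.of_forall fun ω => sq_nonneg _)]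
    -- Comparison with the zero predictor bounds the error by E U_n², which is finite.
    refine (hg.le (fun _ => 0) measurable_const).trans_lt ?_
    rw [meanSqError_eq_ofReal_norm_sq (h.memLp_input n) (memLp_const 0)]
    exact ENNReal.ofReal_lt_top
  have hg2 : MemLp (fun ω => g (infinitePast V n ω)) 2 P := by
    have := (h.memLp_input n).sub hZ2
    convert! this using 1
    ext ω
    simp
  have hgr := h.inner_toLp_comp_infinitePast_eq_zero h0 hcov hr hg.measurable hg2
  have hle : ∀ L, ‖(h.memLp_input n).toLp - hg2.toLp‖ ≤
      ‖(h.memLp_affineResidual (a L) (c L) n L).toLp‖ := by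
    intro L
    let k : (ℕ → ℝ) → ℝ := fun x => ∑ i ∈ Finset.range L, a L i * x i + c L
    have hk : Measurable k := by fun_prop
    have hk2 : MemLp (fun ω => k (infinitePast V n ω)) 2 P :=
      (memLp_finsetSum _ fun _ _ => (h.memLp_output _).const_mul _).add (memLp_const _)
    have h1 := hg.le k hk
    rw [meanSqError_eq_ofReal_norm_sq (h.memLp_input n) hg2,
      meanSqError_eq_ofReal_norm_sq (h.memLp_input n) hk2,
      ENNReal.ofReal_le_ofReal_iff (sq_nonneg _)] at h1
    exact le_of_sq_le_sq h1 (norm_nonneg _)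
  have hle' : ‖(h.memLp_input n).toLp - hg2.toLp‖ ≤ ‖r‖ := ge_of_tendsto' hr.norm hle
  have hpr : ∀ L, ⟪r, (h.memLp_input n).toLp -
      (h.memLp_affineResidual (a L) (c L) n L).toLp⟫ = 0 := by
    intro L
    let k : (ℕ → ℝ) → ℝ := fun x => ∑ i ∈ Finset.range L, a L i * x i + c L
    have hk : Measurable k := by fun_prop
    have hk2 : MemLp (fun ω => k (infinitePast V n ω)) 2 P :=
      (memLp_finsetSum _ fun _ _ => (h.memLp_output _).const_mul _).add (memLp_const _)
    have h1 := h.inner_toLp_comp_infinitePast_eq_zero h0 hcov hr hk hk2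
    have h2 : hk2.toLp = (h.memLp_input n).toLp -
        (h.memLp_affineResidual (a L) (c L) n L).toLp := by
      rw [← MemLp.toLp_sub]
      congr 1
      ext ω
      simp [k, affineResidual, infinitePast]
    rwa [h2] at h1
  have hur : ⟪r, (h.memLp_input n).toLp - r⟫ = 0 := by
    have h1 : Tendsto (fun L => ⟪r, (h.memLp_input n).toLp -
        (h.memLp_affineResidual (a L) (c L) n L).toLp⟫) atTop
        (𝓝 ⟪r, (h.memLp_input n).toLp - r⟫) :=
      tendsto_const_nhds.inner (tendsto_const_nhds.sub hr)
    simp only [hpr] at h1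
    exact (tendsto_nhds_unique h1 tendsto_const_nhds)
  -- Since `r` is orthogonal both to the optimum prediction and to `u - r`, Pythagoras together with
  -- ‖u - g‖ ≤ ‖r‖ forces equality.
  have heq : (h.memLp_input n).toLp - hg2.toLp = r := by
    have h1 : ⟪r, (h.memLp_input n).toLp - hg2.toLp - r⟫ = 0 := by
      rw [inner_sub_right] at hur
      rw [inner_sub_right, inner_sub_right, hgr]
      linarith
    have h2 : ‖(h.memLp_input n).toLp - hg2.toLp‖ ^ 2 =
        ‖r‖ ^ 2 + ‖(h.memLp_input n).toLp - hg2.toLp - r‖ ^ 2 := by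
      have := norm_add_sq_real r ((h.memLp_input n).toLp - hg2.toLp - r)
      rw [h1, add_sub_cancel] at this
      linarith
    have h3 : ‖(h.memLp_input n).toLp - hg2.toLp‖ ^ 2 ≤ ‖r‖ ^ 2 :=
      pow_le_pow_left₀ (norm_nonneg _) hle' 2
    have h4 : ‖(h.memLp_input n).toLp - hg2.toLp - r‖ ^ 2 = 0 :=
      le_antisymm (by linarith) (sq_nonneg _)
    exact sub_eq_zero.1 (norm_eq_zero.1 (pow_eq_zero_iff two_ne_zero |>.1 h4))
  rw [← heq, ← MemLp.toLp_sub]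
  exact (MemLp.coeFn_toLp ((h.memLp_input n).sub hg2)).symm

end IsGaussianChannel

lemma norm_toLp_sq_eq_variance {Ω : Type*} [MeasurableSpace Ω] {P : Measure Ω}
    {X : Ω → ℝ} (hX : MemLp X 2 P) (h0 : ∫ ω, X ω ∂P = 0) : ‖hX.toLp‖ ^ 2 = Var[X; P] := by
  rw [← real_inner_self_eq_norm_sq, inner_toLp_eq_integral,
    variance_of_integral_eq_zero hX.1.aemeasurable h0]
  simp only [pow_two]

/-! ### Linear versus affine prediction. -/

namespace IsGaussianChannel

variable {Ω : Type*} [mΩ : MeasurableSpace Ω] {P : Measure Ω} {θ : ℝ≥0}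
  {U N V : ℤ → Ω → ℝ}

/-- The errors of the optimum linear predictors tend to that of the optimum affine predictor of
infinite order, even if the processes are not centred. -/
lemma tendsto_linearPredictionError [IsProbabilityMeasure P] (h : IsGaussianChannel P θ U N V)
    (n : ℤ) {r : Lp ℝ 2 P}
    (hmem : (h.memLp_input n).toLp - r ∈ (Submodule.span ℝ (insert ((memLp_const 1).toLp)
      (Set.range fun i : ℕ => (h.memLp_output (n - ((i : ℤ) + 1))).toLp))).topologicalClosure)
    (h1 : ⟪(memLp_const (1 : ℝ)).toLp, r⟫ = 0)
    (hv : ∀ i : ℕ, ⟪(h.memLp_output (n - ((i : ℤ) + 1))).toLp, r⟫ = 0) :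
    Tendsto (fun L => linearPredictionError P U V n L) atTop (𝓝 (ENNReal.ofReal (‖r‖ ^ 2))) := by
  set u : Lp ℝ 2 P := (h.memLp_input n).toLp with hu
  let w : ℕ → Lp ℝ 2 P := fun i => (h.memLp_output (n - (i : ℤ))).toLp
  have hwv : ∀ i : ℕ, w (i + 1) = (h.memLp_output (n - ((i : ℤ) + 1))).toLp := by
    intro i
    simp only [w]
    push_cast
    rfl
  simp only [← hwv] at hmem hv
  set e : Lp ℝ 2 P := (memLp_const (1 : ℝ)).toLp with he
  have hee : ∀ {X : Ω → ℝ} (hX : MemLp X 2 P), ⟪e, hX.toLp⟫ = ∫ ω, X ω ∂P := by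
    intro X hX
    rw [he, inner_toLp_eq_integral]
    simp
  have hpre : ∀ L (b : ℕ → ℝ), meanSqError P (U n)
      (fun ω => ∑ i : Fin L, b i * V (n - ((i : ℤ) + 1)) ω) =
        ENNReal.ofReal (‖u - ∑ i ∈ Finset.range L, b i • w (i + 1)‖ ^ 2) := by
    intro L b
    simp only [hwv]
    rw [← toLp_sum_const_mul (fun i : ℕ => h.memLp_output (n - ((i : ℤ) + 1))) b (Finset.range L),
      hu, ← meanSqError_eq_ofReal_norm_sq]
    simp only [Finset.sum_range]
  let T : ℕ → Submodule ℝ (Lp ℝ 2 P) := fun L =>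
    Submodule.span ℝ ((fun i => w (i + 1)) '' (Finset.range L : Set ℕ))
  have hTfin : ∀ L, FiniteDimensional ℝ (T L) := fun L =>
    FiniteDimensional.span_of_finite ℝ ((Finset.range L).finite_toSet.image _)
  have hTmono : Monotone T := fun L L' hL => Submodule.span_mono
    (Set.image_mono (by simpa using hL))
  have hTsup : ⨆ L, T L = Submodule.span ℝ (Set.range fun i => w (i + 1)) := by
    rw [← Submodule.span_iUnion]
    congr 1
    ext x
    simp only [Set.mem_iUnion, Set.mem_image, Set.mem_range, Finset.coe_range, Set.mem_Iio]
    exact ⟨fun ⟨L, i, _, hx⟩ => ⟨i, hx⟩, fun ⟨i, hx⟩ => ⟨i + 1, i, Nat.lt_succ_self i, hx⟩⟩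
  let C := (⨆ L, T L).topologicalClosure
  have hC : CompleteSpace C := (Submodule.isClosed_topologicalClosure _).completeSpace_coe
  have horthe : ⟪e, u - C.starProjection u⟫ = 0 := by
    have := inner_sub_starProjection_eq_zero_of_stationary (w := w) (u := u) (e := e)
      (c := ∫ ω, V n ω ∂P)
      (fun i j => by
        simp only [w]
        rw [inner_toLp_eq_integral, inner_toLp_eq_integral]
        exact h.integral_output_mul_output (by push_cast; ring))
      (fun i => by
        simp only [w, hu]
        rw [inner_toLp_eq_integral, inner_toLp_eq_integral, h.integral_input_mul_output (by omega)]
        simp)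
      (fun i => by rw [hee, h.integral_output_eq])
      (by rw [hu, hee, h.integral_output])
    simp only [C, hTsup]
    exact this
  -- the limit of the affine errors is the limit of the linear errors
  have hr : u - C.starProjection u = r := by
    have hd : r - (u - C.starProjection u) ∈ (Submodule.span ℝ (insert e
        (Set.range fun i => w (i + 1)))).topologicalClosure := by
      have h2 : r - (u - C.starProjection u) = C.starProjection u - (u - r) := by abel
      rw [h2]
      refine sub_mem ?_ hmem
      have h3 := Submodule.starProjection_apply_mem C u
      simp only [C, hTsup] at h3 ⊢
      exact Submodule.topologicalClosure_mono (Submodule.span_mono (Set.subset_insert _ _)) h3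
    -- Both errors are orthogonal to the constants and to the past, while their difference lies in
    -- the closed span of these, so it is orthogonal to itself.
    have h3 : ⟪r - (u - C.starProjection u), r - (u - C.starProjection u)⟫ = 0 := by
      refine inner_eq_zero_of_mem_closure_span (fun y hy => ?_) hd
      rw [real_inner_comm]
      rcases hy with rfl | ⟨i, rfl⟩
      · rw [inner_sub_right, h1, horthe, sub_zero]
      · have h4 : ⟪w (i + 1), u - C.starProjection u⟫ = 0 :=
          Submodule.inner_right_of_mem_orthogonal (Submodule.le_topologicalClosure _
            (hTsup ▸ Submodule.subset_span ⟨i, rfl⟩))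
            (Submodule.sub_starProjection_mem_orthogonal (K := C) u)
        change ⟪w (i + 1), _⟫ = 0
        rw [inner_sub_right, hv, h4, sub_zero]
    exact (sub_eq_zero.1 (inner_self_eq_zero.1 h3)).symm
  have hlim : Tendsto (fun L => ENNReal.ofReal (‖u - (T L).starProjection u‖ ^ 2)) atTop
      (𝓝 (ENNReal.ofReal (‖r‖ ^ 2))) := by
    refine ENNReal.tendsto_ofReal (Tendsto.pow (Tendsto.norm ?_) 2)
    rw [← hr]
    exact tendsto_const_nhds.sub (Submodule.starProjection_tendsto_closure_iSup T hTmono u)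
  -- Every linear error is at least that of projection onto `C`; the projection onto `T L` supplies
  -- coefficients for the upper bound.
  refine tendsto_of_tendsto_of_tendsto_of_le_of_le tendsto_const_nhds hlim (fun L => ?_)
    fun L => ?_
  · refine le_iInf fun b => ?_
    let b' : ℕ → ℝ := fun i => if hi : i < L then b ⟨i, hi⟩ else 0
    have hb : ∀ i : Fin L, b i = b' i := fun i => by simp [b']
    simp only [hb]
    rw [hpre L b']
    refine ENNReal.ofReal_le_ofReal ?_
    set x := ∑ i ∈ Finset.range L, b' i • w (i + 1) with hx
    have hxr : ⟪r, C.starProjection u - x⟫ = 0 := by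
      rw [← hr]
      refine Submodule.inner_left_of_mem_orthogonal (sub_mem
        (Submodule.starProjection_apply_mem C u) ?_)
        (Submodule.sub_starProjection_mem_orthogonal (K := C) u)
      refine Submodule.le_topologicalClosure _ (Submodule.mem_iSup_of_mem L ?_)
      exact Submodule.sum_mem _ fun i hi => Submodule.smul_mem _ _ (Submodule.subset_span
        ⟨i, hi, rfl⟩)
    have h2 : u - x = r + (C.starProjection u - x) := by
      rw [← hr]
      abel
    have h3 := norm_add_sq_real r (C.starProjection u - x)
    rw [hxr] at h3
    rw [h2, h3]
    nlinarith [sq_nonneg ‖C.starProjection u - x‖]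
  · obtain ⟨b, hb⟩ := (Submodule.mem_span_image_finset_iff_exists_fun' ℝ).1
      (Submodule.starProjection_apply_mem (T L) u)
    refine (iInf_le _ fun i : Fin L => b i).trans_eq ?_
    rw [hpre L b, hb]

/-- Coefficients optimal at one time are optimal at every time, so a single family serves the whole
block. -/
lemma covariance_affineResidual_eq [IsProbabilityMeasure P] (h : IsGaussianChannel P θ U N V)
    (a : ℕ → ℝ) (c : ℝ) (L i : ℕ) (m n : ℤ) :
    cov[affineResidual U V a c m L, V (m - ((i : ℤ) + 1)); P] =
      cov[affineResidual U V a c n L, V (n - ((i : ℤ) + 1)); P] := by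
  have hid := h.identDistrib_affineResidual a c L (-((i : ℤ) + 1)) m n
  simp only [neg_add_eq_sub] at hid
  rw [covariance_eq_sub (h.memLp_affineResidual _ _ _ _) (h.memLp_output _),
    covariance_eq_sub (h.memLp_affineResidual _ _ _ _) (h.memLp_output _)]
  congr 1
  · exact (hid.comp (u := fun z => z.1 * z.2) (by fun_prop)).integral_eq
  · congr 1
    · exact (hid.comp measurable_fst).integral_eq
    · exact (hid.comp measurable_snd).integral_eq

lemma identDistrib_affineResidual_fst [IsProbabilityMeasure P] (h : IsGaussianChannel P θ U N V)
    (a : ℕ → ℝ) (c : ℝ) (L : ℕ) (m n : ℤ) :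
    IdentDistrib (affineResidual U V a c m L) (affineResidual U V a c n L) P P :=
  (h.identDistrib_affineResidual a c L 0 m n).comp measurable_fst

end IsGaussianChannel

/-! ### Innovations and the information between blocks. -/

/-- The unit lower triangular matrix that takes `y` to its innovations
`y k - ∑ i < k, a k i * y (k - 1 - i)`. -/
def innovationMatrix (a : ℕ → ℕ → ℝ) (m : ℕ) : Matrix (Fin m) (Fin m) ℝ := fun k j =>
  if j = k then 1 else if j < k then -a k (k - 1 - j) else 0

lemma det_innovationMatrix (a : ℕ → ℕ → ℝ) (m : ℕ) : (innovationMatrix a m).det = 1 := by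
  rw [Matrix.det_of_isLowerTriangular]
  · simp [innovationMatrix]
  · intro i j hij
    have hij' : i < j := hij
    simp [innovationMatrix, hij'.ne', hij'.not_gt]

lemma innovationMatrix_mulVec (a : ℕ → ℕ → ℝ) (m : ℕ) (y : ℕ → ℝ) (k : Fin m) :
    (innovationMatrix a m).mulVec (fun j => y j) k =
      y k - ∑ i ∈ Finset.range k, a k i * y (k - 1 - i) := by
  have h1 : (innovationMatrix a m).mulVec (fun j => y j) k =
      ∑ j ∈ Finset.range m, ((if j = (k : ℕ) then y j else 0) -
        if j < (k : ℕ) then a k (k - 1 - j) * y j else 0) := by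
    rw [Matrix.mulVec, dotProduct, Finset.sum_range]
    refine Finset.sum_congr rfl fun j _ => ?_
    by_cases hjk : j = k
    · subst hjk
      simp [innovationMatrix]
    · have hjk' : (j : ℕ) ≠ k := fun hh => hjk (Fin.ext hh)
      by_cases hlt : j < k
      · have hlt' : (j : ℕ) < k := hlt
        simp [innovationMatrix, hjk, hjk', hlt, hlt']
      · have hlt' : ¬ (j : ℕ) < k := hlt
        simp [innovationMatrix, hjk, hjk', hlt, hlt']
  have h2 : (Finset.range m).filter (fun j => j < (k : ℕ)) = Finset.range k := by
    ext j
    have := k.2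
    simp only [Finset.mem_filter, Finset.mem_range]
    omega
  -- Matrix columns run forward in time, while predictor coefficients start from the most recent
  -- output; hence the reflection of the sum.
  rw [h1, Finset.sum_sub_distrib, Finset.sum_ite_eq', if_pos (Finset.mem_range.2 k.2),
    ← Finset.sum_filter, h2, ← Finset.sum_range_reflect]
  congr 1
  refine Finset.sum_congr rfl fun j hj => ?_
  have : (k : ℕ) - 1 - ((k : ℕ) - 1 - j) = j := by
    have := Finset.mem_range.1 hj
    omega
  rw [this]

namespace IsGaussianChannel

variable {Ω : Type*} [mΩ : MeasurableSpace Ω] {P : Measure Ω} {θ : ℝ≥0}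
  {U N V : ℤ → Ω → ℝ}

lemma innovation_eq (h : IsGaussianChannel P θ U N V) (a : ℕ → ℕ → ℝ) (c : ℕ → ℝ) (m : ℕ)
    (k : Fin m) (ω : Ω) :
    ((innovationMatrix a m).mulVec ((fun i : Fin m => U ((i : ℤ) + 1) ω) +
        fun i : Fin m => N ((i : ℤ) + 1) ω) - fun i : Fin m => c i) k =
      affineResidual U V (a k) (c k) ((k : ℤ) + 1) k ω + N ((k : ℤ) + 1) ω := by
  have h1 : ((fun i : Fin m => U ((i : ℤ) + 1) ω) + fun i : Fin m => N ((i : ℤ) + 1) ω) =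
      fun i : Fin m => (fun j : ℕ => V ((j : ℤ) + 1) ω) i := by
    ext i
    simp [h.output]
  have h2 : V ((k : ℤ) + 1) ω = U ((k : ℤ) + 1) ω + N ((k : ℤ) + 1) ω := by
    rw [h.output, Pi.add_apply]
  rw [Pi.sub_apply, h1, innovationMatrix_mulVec a m (fun j : ℕ => V ((j : ℤ) + 1) ω) k,
    affineResidual, h2]
  have h3 : ∑ i ∈ Finset.range k, a k i * V ((((k : ℕ) - 1 - i : ℕ) : ℤ) + 1) ω =
      ∑ i ∈ Finset.range k, a k i * V ((k : ℤ) + 1 - ((i : ℤ) + 1)) ω := by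
    refine Finset.sum_congr rfl fun i hi => ?_
    have := Finset.mem_range.1 hi
    congr 3
    omega
  rw [h3]
  ring

/-- The mutual information between finite blocks of the input and the output, in terms of the errors
of optimum affine prediction. -/
lemma mutualInfo_block [IsProbabilityMeasure P] (h : IsGaussianChannel P θ U N V)
    (hθ : θ ≠ 0)
    {n : ℤ} {a : ℕ → ℕ → ℝ} {c : ℕ → ℝ}
    (h0 : ∀ L, ∫ ω, affineResidual U V (a L) (c L) n L ω ∂P = 0)
    (hcov : ∀ L, ∀ i < L,
      cov[affineResidual U V (a L) (c L) n L, V (n - ((i : ℤ) + 1)); P] = 0) (m : ℕ) :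
    mutualInfo P (fun ω (i : Fin m) => U ((i : ℤ) + 1) ω) (fun ω (i : Fin m) => V ((i : ℤ) + 1) ω) =
      ENNReal.ofReal (∑ k ∈ Finset.range m,
        Real.log (((Var[affineResidual U V (a k) (c k) n k; P].toNNReal + θ : ℝ≥0) : ℝ) / θ) / 2)
      := by
  -- The order at time k + 1 is exactly k, because the block holds only V_1, …, V_k before that
  -- time.
  let R : ℕ → Ω → ℝ := fun k => affineResidual U V (a k) (c k) ((k : ℤ) + 1) k
  let E : ℕ → Ω → ℝ := fun k => R k + N ((k : ℤ) + 1)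
  have hR2 : ∀ k, MemLp (R k) 2 P := fun k => h.memLp_affineResidual _ _ _ _
  have hE2 : ∀ k, MemLp (E k) 2 P := fun k => (hR2 k).add (h.memLp_noise _)
  have hEm : ∀ k, Measurable (E k) := fun k =>
    (h.measurable_affineResidual _ _ _ _).add (h.measurable_noise _)
  have hR0 : ∀ k, ∫ ω, R k ω ∂P = 0 := fun k =>
    ((h.identDistrib_affineResidual_fst (a k) (c k) k ((k : ℤ) + 1) n).integral_eq).trans (h0 k)
  have hRvar : ∀ k, Var[R k; P] = Var[affineResidual U V (a k) (c k) n k; P] := fun k =>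
    (h.identDistrib_affineResidual_fst (a k) (c k) k ((k : ℤ) + 1) n).variance_eq
  have hRV : ∀ k l : ℕ, l < k → cov[R k, V ((l : ℤ) + 1); P] = 0 := by
    intro k l hl
    have h1 := (h.covariance_affineResidual_eq (a k) (c k) k (k - 1 - l) ((k : ℤ) + 1) n).trans
      (hcov k (k - 1 - l) (by omega))
    have h2 : (k : ℤ) + 1 - (((k - 1 - l : ℕ) : ℤ) + 1) = (l : ℤ) + 1 := by omega
    rwa [h2] at h1
  have hEV : ∀ k l : ℕ, l < k → cov[E k, V ((l : ℤ) + 1); P] = 0 := by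
    intro k l hl
    rw [covariance_add_left (hR2 k) (h.memLp_noise _) (h.memLp_output _), hRV k l hl,
      h.covariance_noise_output (by omega), add_zero]
  have hEsum : ∀ k, E k = fun ω => (V ((k : ℤ) + 1) - fun ω => ∑ i ∈ Finset.range k,
      a k i * V ((k : ℤ) + 1 - ((i : ℤ) + 1)) ω) ω - c k := by
    intro k
    ext ω
    simp only [E, R, affineResidual, Pi.add_apply, Pi.sub_apply, h.output]
    ring
  have hNR : ∀ k, cov[R k, N ((k : ℤ) + 1); P] = 0 := by
    intro k
    have hs : MemLp (fun ω => ∑ i ∈ Finset.range k,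
        a k i * V ((k : ℤ) + 1 - ((i : ℤ) + 1)) ω) 2 P :=
      memLp_finsetSum _ fun _ _ => (h.memLp_output _).const_mul _
    have h1 : R k = fun ω => (U ((k : ℤ) + 1) - fun ω => ∑ i ∈ Finset.range k,
        a k i * V ((k : ℤ) + 1 - ((i : ℤ) + 1)) ω) ω - c k := by
      ext ω
      simp only [R, affineResidual, Pi.sub_apply]
      ring
    rw [h1, covariance_comm, covariance_sub_const_right
      (((h.memLp_input _).sub hs).integrable one_le_two),
      covariance_sub_right (h.memLp_noise _) (h.memLp_input _) hs, h.covariance_noise_input,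
      covariance_fun_sum_right' (fun i _ => (h.memLp_output _).const_mul _) (h.memLp_noise _),
      zero_sub, neg_eq_zero]
    refine Finset.sum_eq_zero fun i hi => ?_
    rw [covariance_const_mul_right, h.covariance_noise_output (by omega), mul_zero]
  -- `E l` is affine in the outputs up to time l + 1, all of which are uncorrelated with `E k`.
  have hEE : ∀ k l : ℕ, l < k → cov[E k, E l; P] = 0 := by
    intro k l hl
    have hs : MemLp (fun ω => ∑ i ∈ Finset.range l,
        a l i * V ((l : ℤ) + 1 - ((i : ℤ) + 1)) ω) 2 P :=
      memLp_finsetSum _ fun _ _ => (h.memLp_output _).const_mul _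
    rw [hEsum l, covariance_sub_const_right (((h.memLp_output _).sub hs).integrable one_le_two),
      covariance_sub_right (hE2 k) (h.memLp_output _) hs, hEV k l hl,
      covariance_fun_sum_right' (fun i _ => (h.memLp_output _).const_mul _) (hE2 k),
      zero_sub, neg_eq_zero]
    refine Finset.sum_eq_zero fun i hi => ?_
    have hi' := Finset.mem_range.1 hi
    have h2 : (l : ℤ) + 1 - ((i : ℤ) + 1) = ((l - 1 - i : ℕ) : ℤ) + 1 := by omega
    rw [covariance_const_mul_right, h2, hEV k _ (by omega), mul_zero]
  have hEspan : ∀ k, (fun ω => E k ω + c k) ∈ Submodule.span ℝ (Set.range (Sum.elim U N)) := by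
    intro k
    have h1 : (fun ω => E k ω + c k) = (fun ω => R k ω + c k) + N ((k : ℤ) + 1) := by
      ext ω
      simp only [E, Pi.add_apply]
      ring
    rw [h1]
    exact add_mem (h.affineResidual_add_const_mem_span _ _ _ _) (mem_span_sumElim_inr U N _)
  have hEG := isGaussianProcess_of_mem_span (Y := fun k ω => E k ω + c k)
    h.isGaussianProcess_sumElim hEspan
  have hElaw : ∀ k, HasLaw (E k) (gaussianReal 0 (Var[R k; P].toNNReal + θ)) P := by
    intro k
    have hG : HasGaussianLaw (E k) P := hasGaussianLaw_of_add_const (hEm k)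
      (hEG.hasGaussianLaw_eval k)
    refine ⟨(hEm k).aemeasurable, ?_⟩
    rw [hG.map_eq_gaussianReal]
    congr 1
    · simp only [E, Pi.add_apply]
      rw [integral_add ((hR2 k).integrable one_le_two)
        ((h.memLp_noise _).integrable one_le_two), hR0, h.integral_noise, add_zero]
    · rw [variance_add (hR2 k) (h.memLp_noise _), hNR, h.variance_noise, mul_zero, add_zero,
        Real.toNNReal_add (variance_nonneg _ _) (NNReal.coe_nonneg θ),
        Real.toNNReal_coe]
  have hEind : iIndepFun (fun (k : Fin m) => E k) P := by
    have h1 : IsGaussianProcess (fun (p : (_ : Fin m) × Unit) ω => E p.1 ω + c p.1) P :=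
      hEG.comp_right fun p : (_ : Fin m) × Unit => (p.1 : ℕ)
    have h2 := IsGaussianProcess.iIndepFun_of_covariance_eq_zero
      (X := fun (k : Fin m) (_ : Unit) ω => E k ω + c k) h1
      (fun k _ => ((hEm k).add_const _).aemeasurable) (by
        intro k l hkl _ _
        rw [covariance_add_const_left ((hE2 k).integrable one_le_two),
          covariance_add_const_right ((hE2 l).integrable one_le_two)]
        rcases lt_or_gt_of_ne fun hh : (k : ℕ) = l => hkl (Fin.ext hh) with hlt | hlt
        · rw [covariance_comm]
          exact hEE l k hlt
        · exact hEE k l hlt)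
    have h3 := h2.comp (fun (k : Fin m) (x : Unit → ℝ) => x () - c k) fun k => by fun_prop
    convert! h3 using 1
    ext k ω
    simp
  have hNind : iIndepFun (fun (i : Fin m) => N ((i : ℤ) + 1)) P :=
    h.noise.iIndepFun.precomp (g := fun i : Fin m => (i : ℤ) + 1) fun i j hij => by
      have : (i : ℤ) + 1 = (j : ℤ) + 1 := hij
      exact Fin.ext (by omega)
  have key := mutualInfo_add_gaussian (P := P)
    (X := fun ω (i : Fin m) => U ((i : ℤ) + 1) ω) (N := fun ω (i : Fin m) => N ((i : ℤ) + 1) ω)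
    (measurable_pi_iff.2 fun _ => h.measurable_input _)
    (measurable_pi_iff.2 fun _ => h.measurable_noise _)
    (h.indep.comp (φ := fun (x : ℤ → ℝ) (i : Fin m) => x ((i : ℤ) + 1))
      (ψ := fun (x : ℤ → ℝ) (i : Fin m) => x ((i : ℤ) + 1)) (by fun_prop) (by fun_prop))
    hθ (fun i => h.noise.hasLaw _) hNind (det_innovationMatrix a m) (fun i : Fin m => c i)
    (s := fun k : Fin m => Var[R k; P].toNNReal + θ)
    (fun k => (lt_of_lt_of_le (pos_iff_ne_zero.2 hθ) le_add_self).ne')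
    (fun k => by
      simp only [h.innovation_eq a c m]
      exact hElaw k)
    (by
      simp only [h.innovation_eq a c m]
      exact hEind)
  simp only [hRvar] at key
  have hV : (fun ω (i : Fin m) => V ((i : ℤ) + 1) ω) = fun ω =>
      (fun i : Fin m => U ((i : ℤ) + 1) ω) + fun i : Fin m => N ((i : ℤ) + 1) ω := by
    ext ω i
    simp [h.output]
  rw [hV, Finset.sum_range]
  exact key

/-- The error of a prediction from the infinite past of the output is independent of the noise. -/
lemma indepFun_error_noise [IsProbabilityMeasure P] (h : IsGaussianChannel P θ U N V)
    {n : ℤ}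
    {g : (ℕ → ℝ) → ℝ} (hg : Measurable g) :
    IndepFun (fun ω => U n ω - g (infinitePast V n ω)) (N n) P := by
  -- U_n and the past outputs are taken jointly: their independence from N_n passes to any
  -- measurable function, so `g` need not be linear.
  let X : Unit ⊕ ℕ → Ω → ℝ := Sum.elim (fun _ => U n) fun i => V (n - ((i : ℤ) + 1))
  have hG : IsGaussianProcess (Sum.elim X fun _ : Unit => N n) P :=
    isGaussianProcess_of_mem_span h.isGaussianProcess_sumElim (by
      rintro ((_ | i) | _)
      · exact mem_span_sumElim_inl U N n
      · exact h.output_mem_span _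
      · exact mem_span_sumElim_inr U N n)
  have hind := hG.indepFun_of_covariance_eq_zero
    (by
      rintro (_ | i)
      · exact (h.measurable_input n).aemeasurable
      · exact (h.measurable_output _).aemeasurable)
    (fun _ => (h.measurable_noise n).aemeasurable) (by
      rintro (_ | i) _
      · rw [covariance_comm]
        exact h.covariance_noise_input n n
      · rw [covariance_comm]
        exact h.covariance_noise_output (by omega))
  have hφ : Measurable fun x : Unit ⊕ ℕ → ℝ => x (.inl ()) - g fun i => x (.inr i) :=
    (measurable_pi_apply _).sub (hg.comp (measurable_pi_iff.2 fun i => measurable_pi_apply _))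
  exact hind.comp hφ (measurable_pi_apply ())

end IsGaussianChannel

/-! ### The prediction loop. -/

/-- The predictor output cancels whatever `g` is, so the feedback has no effect on the law of the
output. -/
lemma IsPredictionLoop.output_eq {Ω : Type*} {g : ℤ → (ℕ → ℝ) → ℝ}
    {U N Uhat Z Zq V : ℤ → Ω → ℝ} (h : IsPredictionLoop g U N Uhat Z Zq V) (n : ℤ) :
    V n = U n + N n := by
  ext ω
  rw [h.output, h.channel, h.error, Pi.add_apply]
  ring

theorem lemma1 {Ω : Type*} [MeasurableSpace Ω] (P : Measure Ω) [IsProbabilityMeasure P]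
    (θ : ℝ≥0) (hθ : 0 < θ)
    (U N Uhat Z Zq V : ℤ → Ω → ℝ)
    (hUm : ∀ n, Measurable (U n)) (hNm : ∀ n, Measurable (N n))
    (hUgauss : IsGaussianProcess U P) (hUstat : IsStationaryProcess P U)
    (hN : IsWhiteGaussianNoise P N θ)
    (hUN : IndepFun (fun ω n => U n ω) (fun ω n => N n ω) P)
    (g : ℤ → (ℕ → ℝ) → ℝ)
    (hloop : IsPredictionLoop g U N Uhat Z Zq V)
    (hopt : ∀ n, IsOptimalPredictor P U V n (g n)) :
    (∀ n : ℤ, HasMutualInfoRate P U V (mutualInfo P (Z n) (fun ω => Z n ω + N n ω))) ∧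
      (∀ n : ℤ, Tendsto (fun L : ℕ => linearPredictionError P U V n L) atTop
        (𝓝 (evariance (Z n) P))) := by
  have h : IsGaussianChannel P θ U N V := ⟨hUm, hNm, hUgauss, hUstat, hN, hUN, hloop.output_eq⟩
  have hZ : ∀ n, Z n = fun ω => U n ω - g n (infinitePast V n ω) := fun n => by
    ext ω
    rw [hloop.error, hloop.predictor]
  rw [← forall_and]
  intro n
  obtain ⟨a, c, r, h0, hcov, hr, hmem, h1, hv⟩ := h.exists_affinePredictor n
  have hZr : Z n =ᵐ[P] r := by
    rw [hZ]
    exact h.error_ae_eq h0 hcov hr (hopt n)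
  have hZ2 : MemLp (Z n) 2 P := (memLp_congr_ae hZr).2 (Lp.memLp r)
  have hZtoLp : hZ2.toLp = r := by
    refine Lp.ext ?_
    filter_upwards [hZ2.coeFn_toLp, hZr] with ω h2 h3
    rw [h2, h3]
  have hZ0 : ∫ ω, Z n ω ∂P = 0 := by
    rw [← hZtoLp, inner_toLp_eq_integral] at h1
    simpa using h1
  have hZvar : Var[Z n; P] = ‖r‖ ^ 2 := by rw [← hZtoLp, norm_toLp_sq_eq_variance hZ2 hZ0]
  refine ⟨?_, ?_⟩
  · have hvar : Tendsto (fun L => Var[affineResidual U V (a L) (c L) n L; P].toNNReal) atTop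
        (𝓝 Var[Z n; P].toNNReal) := by
      simp only [fun L => (norm_toLp_sq_eq_variance (h.memLp_affineResidual (a L) (c L) n L)
        (h0 L)).symm]
      rw [hZvar]
      exact (continuous_real_toNNReal.tendsto _).comp (hr.norm.pow 2)
    have hZlaw : HasLaw (Z n) (gaussianReal 0 Var[Z n; P].toNNReal) P := by
      refine hasLaw_gaussianReal_of_tendsto (fun L => h.hasLaw_affineResidual (h0 L)) hvar ?_
      exact (tendstoInMeasure_of_tendsto_Lp hr).congr (fun L => MemLp.coeFn_toLp _) hZr.symm
    have hZm : Measurable (Z n) := by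
      rw [hZ]
      exact (hUm n).sub ((hopt n).measurable.comp
        (measurable_infinitePast fun i => h.measurable_output _))
    have hZN : IndepFun (Z n) (N n) P := by
      rw [hZ]
      exact h.indepFun_error_noise (hopt n).measurable
    rw [mutualInfo_add_gaussian_real hZm (hNm n) hZN hθ.ne' hZlaw (hN.hasLaw n), HasMutualInfoRate]
    have hlog : Tendsto (fun k => Real.log
        (((Var[affineResidual U V (a k) (c k) n k; P].toNNReal + θ : ℝ≥0) : ℝ) / θ) / 2) atTop
        (𝓝 (Real.log (((Var[Z n; P].toNNReal + θ : ℝ≥0) : ℝ) / θ) / 2)) := by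
      have hθ' : (0 : ℝ) < θ := hθ
      have hpos : (0 : ℝ) < ((Var[Z n; P].toNNReal + θ : ℝ≥0) : ℝ) / θ :=
        div_pos (NNReal.coe_pos.2 (lt_of_lt_of_le hθ le_add_self)) hθ'
      exact (((NNReal.tendsto_coe.2 (hvar.add_const θ)).div_const _).log hpos.ne').div_const _
    -- The normalised block information is a Cesàro mean of the convergent per-symbol terms; m = 0
    -- is discarded in order to divide.
    refine (ENNReal.tendsto_ofReal hlog.cesaro).congr' ?_
    filter_upwards [eventually_gt_atTop 0] with m hm
    have hm' : (0 : ℝ) < m := Nat.cast_pos.2 hm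
    rw [h.mutualInfo_block hθ.ne' h0 hcov m, inv_mul_eq_div, ENNReal.ofReal_div_of_pos hm',
      ENNReal.ofReal_natCast]
  · rw [← ofReal_variance hZ2, hZvar]
    exact h.tendsto_linearPredictionError n hmem h1 hv
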